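/- Let $\mathcal H$ be a separable complex Hilbert space. Let $X$ be the real vector space of self-adjoint trace class operators on $\mathcal H$ with trace $0$, and let $\Xi$ be the real Hilbert space obtained as the closure of $X$ in the space of Hilbert--Schmidt operators, with inner product $(S,T)=\operatorname{Re}\operatorname{Tr}[S^*T]$. Let $\rho_0$ be a density operator, let $\theta\in X$ be such that $\rho:=\rho_0+\theta>0$ (i.e. $\langle x,\rho x\rangle>0$ for all $x\ne0$), and write $\langle A\rangle_{\theta'}=\operatorname{Tr}[(\rho_0+\theta')A]$. Let $A$ be a self-adjoint, possibly unbounded, operator such that $\rho A$ and $\rho A^2$ are (extend to) trace class operators, put $\sigma^2_\theta(A)=\operatorname{Tr}[\rho A^2]-\operatorname{Tr}[\rho A]^2$, and let $P^A$ be the spectral measure of $A$. Consider the measurement $M=P^A$, with outcome distribution $P_\theta(B)=\operatorname{Tr}[\rho P^A(B)]$ on $\mathbb R$. For $\varphi\in X$ let the logarithmic derivative $l(\varphi)$ be the density of $B\mapsto\operatorname{Tr}[\varphi P^A(B)]$ with respect to $P_\theta$, and say that $\varphi$ has finite Fisher information if $l(\varphi)\in L^2(P_\theta)$. (1) Suppose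 that $\theta'\mapsto\langle A\rangle_{\theta'}$, on $\{\theta'\in X:\rho_0+\theta'>0\}$ with the norm of $\Xi$, is finite near $\theta$ and differentiable at $\theta$ with gradient $\nabla_\theta\langle A\rangle_\theta\in\Xi$; that the Fisher information operator exists, i.e. all $\varphi\in X$ have finite Fisher information and there is a bounded operator $J$ on $\Xi$ with $(\varphi,J\chi)=\int l(\varphi)\,l(\chi)\,dP_\theta$ for $\varphi,\chi\in X$; and that $J$ has a bounded Moore--Penrose inverse $J^+$. Then the measurement error $$\varepsilon(A;\rho,P^A)=\begin{cases}(\nabla_\theta\langle A\rangle_\theta,J^+\nabla_\theta\langle A\rangle_\theta)-\sigma_\theta^2(A)&\text{if }\nabla_\theta\langle A\rangle_\theta\in(\ker J)^\perp,\\+\infty&\text{otherwise}\end{cases}$$ is equal to $0$. (2) Without the additional assumptions of (1), the measurement error vanishes in the following weak sense. If $\varphi\in X$ has finite Fisher information, $\varphi A$ is trace class and $\int l(\varphi)^2\,dP_\theta=0$, then $\operatorname{Tr}[\varphi A]=0$. There is $\psi\in X$ of finite Fisher information such that $$\int l(\psi)\,l(\chi)\,dP_\theta=\operatorname{Tr}[\chi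 A]\quad\text{for all }\chi\in X\text{ of finite Fisher information with }\chi A\text{ trace class}$$ (the weak form of $J\psi=\nabla_\theta\langle A\rangle_\theta$), and every such $\psi$ satisfies $\int l(\psi)^2\,dP_\theta-\sigma_\theta^2(A)=0$. -/

import Mathlib

open MeasureTheory
open scoped InnerProductSpace ENNReal

noncomputable section

namespace QMeas

/-! ### Trace class operators, trace, expectation of an observable -/

section Trace

variable {ι H : Type*} [NormedAddCommGroup H] [InnerProductSpace ℂ H] [CompleteSpace H]

/-- `T` is trace class: `Tr |T| < ∞`, where `|T| = √(T* T)`. (As `|T| ≥ 0`, this does not depend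
on the orthonormal basis.) -/
def IsTraceClass (b : HilbertBasis ι ℂ H) (T : H →L[ℂ] H) : Prop :=
  Summable fun i => (⟪b i, CFC.abs T (b i)⟫_ℂ).re

/-- The trace of a (trace class) operator. -/
def trace (b : HilbertBasis ι ℂ H) (T : H →L[ℂ] H) : ℂ :=
  ∑' i, ⟪b i, T (b i)⟫_ℂ

/-- `S` is a density operator. -/
structure IsDensity (b : HilbertBasis ι ℂ H) (S : H →L[ℂ] H) : Prop where
  isPositive : S.IsPositive
  traceClass : IsTraceClass b S
  trace_eq_one : trace b S = 1

/-- `S > 0`: `⟪x, S x⟫ > 0` for every `x ≠ 0`, with `S` self-adjoint. -/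
def IsStrictlyPositiveOp (S : H →L[ℂ] H) : Prop :=
  IsSelfAdjoint S ∧ ∀ x : H, x ≠ 0 → 0 < (⟪x, S x⟫_ℂ).re

/-- The bounded operator `T` is a trace class extension of the product `S A`, where `A` may be
unbounded. If `A` is densely defined there is at most one such `T`. -/
def IsTraceClassProduct (b : HilbertBasis ι ℂ H) (S : H →L[ℂ] H) (A : H →ₗ.[ℂ] H)
    (T : H →L[ℂ] H) : Prop :=
  IsTraceClass b T ∧ ∀ x : A.domain, T x = S (A x)

/-- `S A` is trace class, that is, the expectation value `Tr[S A]` is finite. -/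
def HasFiniteExpectation (b : HilbertBasis ι ℂ H) (S : H →L[ℂ] H) (A : H →ₗ.[ℂ] H) : Prop :=
  ∃ T : H →L[ℂ] H, IsTraceClassProduct b S A T

open Classical in
/-- `Tr[S A]`, for self-adjoint `S` and `A` with `S A` trace class; the trace is then real. -/
def expectation (b : HilbertBasis ι ℂ H) (S : H →L[ℂ] H) (A : H →ₗ.[ℂ] H) : ℝ :=
  if h : HasFiniteExpectation b S A then (trace b h.choose).re else 0

/-- The square of a partially defined operator, with domain `{x ∈ dom A | A x ∈ dom A}`. -/
def pmapSq (A : H →ₗ.[ℂ] H) : H →ₗ.[ℂ] H :=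
  A.comp (A.domRestrict ((A.domain.comap A.toFun).map A.domain.subtype)) (by
    rintro ⟨x, hx, hxA⟩
    obtain ⟨y, hy, hyx⟩ := hx
    have : A.domRestrict ((A.domain.comap A.toFun).map A.domain.subtype)
        ⟨x, ⟨y, hy, hyx⟩, hxA⟩ = A y :=
      LinearPMap.domRestrict_apply hyx.symm
    rw [this]
    exact hy)

/-- The variance `σ²(A) = Tr[ρ A²] - Tr[ρ A]²`. -/
def variance (b : HilbertBasis ι ℂ H) (ρ : H →L[ℂ] H) (A : H →ₗ.[ℂ] H) : ℝ :=
  expectation b ρ (pmapSq A) - expectation b ρ A ^ 2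

/-- The directions in which states can be varied: self-adjoint trace class operators with
trace `0`. -/
structure IsTangent (b : HilbertBasis ι ℂ H) (φ : H →L[ℂ] H) : Prop where
  isSelfAdjoint : IsSelfAdjoint φ
  traceClass : IsTraceClass b φ
  trace_eq_zero : trace b φ = 0

end Trace

/-! ### POVMs, PVMs and spectral measures -/

section Measurements

variable {Ω H : Type*} [MeasurableSpace Ω]
  [NormedAddCommGroup H] [InnerProductSpace ℂ H] [CompleteSpace H]

/-- A positive operator-valued measure (weakly countably additive). Values on non-measurable sets
are irrelevant. -/
structure POVM (Ω H : Type*) [MeasurableSpace Ω]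
    [NormedAddCommGroup H] [InnerProductSpace ℂ H] [CompleteSpace H] where
  /-- The effect of a measurable set. -/
  effect : Set Ω → H →L[ℂ] H
  isPositive : ∀ B, MeasurableSet B → (effect B).IsPositive
  effect_univ : effect Set.univ = 1
  hasSum_effect : ∀ B : ℕ → Set Ω, (∀ n, MeasurableSet (B n)) →
    Pairwise (Function.onFun Disjoint B) →
      ∀ x y : H, HasSum (fun n => ⟪x, effect (B n) y⟫_ℂ) ⟪x, effect (⋃ n, B n) y⟫_ℂ

/-- A POVM is a projection-valued measure if all its effects are orthogonal projections. -/
def POVM.IsPVM (M : POVM Ω H) : Prop :=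
  ∀ B, MeasurableSet B → M.effect B * M.effect B = M.effect B

theorem POVM.inner_effect_empty (M : POVM Ω H) (x : H) : ⟪x, M.effect ∅ x⟫_ℂ = 0 := by
  have h := M.hasSum_effect (fun _ => ∅) (fun _ => MeasurableSet.empty)
    (fun _ _ _ => by simp [Function.onFun]) x x
  exact tendsto_nhds_unique tendsto_const_nhds h.summable.tendsto_atTop_zero

/-- The measure `B ↦ ⟪x, M(B) x⟫`. -/
def POVM.diag (M : POVM Ω H) (x : H) : Measure Ω :=
  Measure.ofMeasurable (fun B _ => ENNReal.ofReal (⟪x, M.effect B x⟫_ℂ).re)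
    (by simp [M.inner_effect_empty x])
    (fun B hB hd => by
      have h := (Complex.hasSum_iff _ _).1 (M.hasSum_effect B hB hd x x)
      have hpos : ∀ n, 0 ≤ (⟪x, M.effect (B n) x⟫_ℂ).re := fun n =>
        (M.isPositive (B n) (hB n)).re_inner_nonneg_right x
      rw [← h.1.tsum_eq]
      exact ENNReal.ofReal_tsum_of_nonneg hpos h.1.summable)

/-- `E` is the spectral measure of the (possibly unbounded) self-adjoint operator `A`:
`dom A = {x | ∫ λ² d⟪x, E x⟫ < ∞}` and `⟪x, A x⟫ = ∫ λ d⟪x, E x⟫` on `dom A`, that is,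
`A = ∫ λ dE(λ)`. -/
structure IsSpectralMeasure (E : POVM ℝ H) (A : H →ₗ.[ℂ] H) : Prop where
  isPVM : E.IsPVM
  mem_domain_iff : ∀ x : H, x ∈ A.domain ↔ Integrable (fun t : ℝ => t ^ 2) (E.diag x)
  inner_apply : ∀ x : A.domain, ⟪(x : H), A x⟫_ℂ = ((∫ t, t ∂(E.diag (x : H)) : ℝ) : ℂ)

end Measurements

/-! ### Outcome distributions, logarithmic derivatives, the Fisher form -/

section Fisher

variable {ι Ω H : Type*} [MeasurableSpace Ω]
  [NormedAddCommGroup H] [InnerProductSpace ℂ H] [CompleteSpace H]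

/-- The outcome distribution `P(B) = Tr[ρ M(B)]`: the unique probability measure with
these values. -/
def outcomeLaw (b : HilbertBasis ι ℂ H) (ρ : H →L[ℂ] H) (M : POVM Ω H) : Measure Ω :=
  Classical.epsilon fun P : Measure Ω => IsProbabilityMeasure P ∧
    ∀ B, MeasurableSet B → P.real B = (trace b (ρ * M.effect B)).re

/-- `l` is a logarithmic derivative of the outcome distribution in the direction `φ`: a density of
the derivative `B ↦ Tr[φ M(B)]` of `B ↦ Tr[(ρ + φ) M(B)]` with respect to the outcome
distribution. -/
def IsLogDeriv (b : HilbertBasis ι ℂ H) (ρ : H →L[ℂ] H) (M : POVM Ω H) (φ : H →L[ℂ] H)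
    (l : Ω → ℝ) : Prop :=
  Integrable l (outcomeLaw b ρ M) ∧
    ∀ B, MeasurableSet B → ∫ x in B, l x ∂(outcomeLaw b ρ M) = (trace b (φ * M.effect B)).re

/-- The logarithmic derivative in the direction `φ` (unique up to null sets). -/
def logDeriv (b : HilbertBasis ι ℂ H) (ρ : H →L[ℂ] H) (M : POVM Ω H) (φ : H →L[ℂ] H) : Ω → ℝ :=
  Classical.epsilon (IsLogDeriv b ρ M φ)

/-- The direction `φ` has finite Fisher information: its logarithmic derivative is in `L²`. -/
def HasFiniteFisher (b : HilbertBasis ι ℂ H) (ρ : H →L[ℂ] H) (M : POVM Ω H)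
    (φ : H →L[ℂ] H) : Prop :=
  MemLp (logDeriv b ρ M φ) 2 (outcomeLaw b ρ M)

/-- The Fisher information form `E[l(φ) l(χ)]`. -/
def fisherForm (b : HilbertBasis ι ℂ H) (ρ : H →L[ℂ] H) (M : POVM Ω H)
    (φ χ : H →L[ℂ] H) : ℝ :=
  ∫ x, logDeriv b ρ M φ x * logDeriv b ρ M χ x ∂(outcomeLaw b ρ M)

/-- `ψ` solves `J ψ = ∇⟨A⟩`, in weak form: `(J ψ, χ) = D⟨A⟩[χ] = Tr[χ A]` for all directions `χ`
of finite Fisher information for which `Tr[χ A]` is finite. -/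
structure SolvesFisherEq (b : HilbertBasis ι ℂ H) (ρ : H →L[ℂ] H) (M : POVM Ω H)
    (A : H →ₗ.[ℂ] H) (ψ : H →L[ℂ] H) : Prop where
  isTangent : IsTangent b ψ
  finiteFisher : HasFiniteFisher b ρ M ψ
  eq : ∀ χ, IsTangent b χ → HasFiniteFisher b ρ M χ → HasFiniteExpectation b χ A →
    fisherForm b ρ M ψ χ = expectation b χ A

end Fisher

/-! ### The parameter Hilbert space, gradients, Fisher information operator, measurement error -/

/-- The Hilbert space of Hilbert–Schmidt operators on `H`, an operator `T` being represented by the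
square-summable family `(T bᵢ)ᵢ`; viewed as a real Hilbert space with inner product
`Re Tr[S* T] = Re ∑ᵢ ⟪S bᵢ, T bᵢ⟫`. -/
def HS (ι H : Type*) [NormedAddCommGroup H] [InnerProductSpace ℂ H] : Type _ :=
  lp (fun _ : ι => H) 2

section HilbertSchmidt

variable {ι H : Type*} [NormedAddCommGroup H] [InnerProductSpace ℂ H]

instance : NormedAddCommGroup (HS ι H) :=
  inferInstanceAs (NormedAddCommGroup (lp (fun _ : ι => H) 2))

instance : InnerProductSpace ℝ (HS ι H) :=
  InnerProductSpace.complexToReal (G := lp (fun _ : ι => H) 2)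

instance [CompleteSpace H] : CompleteSpace (HS ι H) :=
  inferInstanceAs (CompleteSpace (lp (fun _ : ι => H) 2))

open Classical in
/-- A Hilbert–Schmidt operator as an element of `HS ι H`. -/
def toHS (b : HilbertBasis ι ℂ H) (T : H →L[ℂ] H) : HS ι H :=
  if h : Memℓp (fun i => T (b i)) 2 then (⟨fun i => T (b i), h⟩ : lp (fun _ : ι => H) 2)
  else (0 : lp (fun _ : ι => H) 2)

variable [CompleteSpace H]

/-- The parameter space `Ξ`: the Hilbert–Schmidt closure of the self-adjoint trace class operators
with trace `0` (which already form a real subspace; if `dim H < ∞` it is closed). -/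
def paramSpace (b : HilbertBasis ι ℂ H) : Submodule ℝ (HS ι H) :=
  (Submodule.span ℝ (toHS b '' {φ | IsTangent b φ})).topologicalClosure

instance (b : HilbertBasis ι ℂ H) : CompleteSpace (paramSpace b) :=
  (Submodule.isClosed_topologicalClosure _).completeSpace_coe

/-- A direction as an element of `Ξ`. -/
def toParam (b : HilbertBasis ι ℂ H) {φ : H →L[ℂ] H} (hφ : IsTangent b φ) : paramSpace b :=
  ⟨toHS b φ, Submodule.le_topologicalClosure _ (Submodule.subset_span ⟨φ, hφ, rfl⟩)⟩

/-- `g ∈ Ξ` is the gradient at `θ` of the function `θ ↦ ⟨A⟩_θ = Tr[(ρ₀ + θ) A]` on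
`Θ = {θ | ρ₀ + θ > 0}`, where `ρ = ρ₀ + θ`: for small `φ` with `ρ + φ > 0` the expectation value of
`A` in the state `ρ + φ` is finite and differs from `⟨A⟩_θ + (g, φ)` by `o(‖φ‖)`. -/
def IsGradient (b : HilbertBasis ι ℂ H) (ρ : H →L[ℂ] H) (A : H →ₗ.[ℂ] H)
    (g : paramSpace b) : Prop :=
  ∀ ε > 0, ∃ δ > 0, ∀ (φ : H →L[ℂ] H) (hφ : IsTangent b φ),
    IsStrictlyPositiveOp (ρ + φ) → ‖toParam b hφ‖ < δ →
      HasFiniteExpectation b (ρ + φ) A ∧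
      |expectation b (ρ + φ) A - expectation b ρ A - ⟪g, toParam b hφ⟫_ℝ| ≤ ε * ‖toParam b hφ‖

/-- `J` is the Fisher information operator of the measurement `M` in the state `ρ`:
`(φ, J χ) = E[l(φ) l(χ)]`, the logarithmic derivatives being square integrable. -/
def IsFisherOperator {Ω : Type*} [MeasurableSpace Ω] (b : HilbertBasis ι ℂ H) (ρ : H →L[ℂ] H)
    (M : POVM Ω H) (J : paramSpace b →L[ℝ] paramSpace b) : Prop :=
  (∀ φ, IsTangent b φ → HasFiniteFisher b ρ M φ) ∧
  ∀ (φ χ : H →L[ℂ] H) (hφ : IsTangent b φ) (hχ : IsTangent b χ),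
    ⟪toParam b hφ, J (toParam b hχ)⟫_ℝ = fisherForm b ρ M φ χ

end HilbertSchmidt

section MoorePenrose

variable {V : Type*} [NormedAddCommGroup V] [InnerProductSpace ℝ V] [CompleteSpace V]

/-- `G` is the Moore–Penrose inverse of `J`. -/
structure IsMoorePenrose (J G : V →L[ℝ] V) : Prop where
  mul_mul_left : J * G * J = J
  mul_mul_right : G * J * G = G
  left_adjoint : ContinuousLinearMap.adjoint (J * G) = J * G
  right_adjoint : ContinuousLinearMap.adjoint (G * J) = G * J

open Classical in
/-- The measurement error of an observable with gradient `g` and variance `v`, for a measurement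
with Fisher information operator `J` having Moore–Penrose inverse `G`:
`(g, G g) - v` if `g ∈ (ker J)ᗮ`, and `+∞` otherwise. -/
def measurementError (J G : V →L[ℝ] V) (g : V) (v : ℝ) : EReal :=
  if g ∈ (LinearMap.ker (J : V →ₗ[ℝ] V))ᗮ then ((⟪g, G g⟫_ℝ - v : ℝ) : EReal) else ⊤

end MoorePenrose

end QMeas

end

set_option linter.unusedSectionVars false

/-! Write P for the outcome law and ⟨A⟩ for Tr[ρA]. Everything rests on one explicit direction, ψ =
½(ρA + (ρA)*) − ⟨A⟩ρ (`tangentPart`). Since A commutes with its spectral projections, Re Tr[ρA E(C)]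
= ∫_C t dP, so l(ψ) = t − ⟨A⟩ and ∫ l(ψ)² dP is the variance. Any direction χ has ∫ l(χ) dP = Tr χ =
0, so ∫ l(ψ) l(χ) dP = ∫ t l(χ) dP = Tr[χA] (`fisherForm_solution`). This is the weak equation, and
it forces Tr[χA] = 0 when l(χ) = 0. Every solution has the same logarithmic derivative, because the
test directions built from ρE(B) have logarithmic derivative 1_B − P(B) (`logDeriv_ae_eq`).

For the operator form one needs Jψ = g, where g is the gradient (`fisherOperator_apply`).
Differentiability yields (g, χ) = Tr[χA] only where ρ + εχ stays strictly positive for small ε > 0.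
This holds for χ = √ρ K √ρ with K bounded self-adjoint, and the trace-zero directions of this kind
are dense: conjugate by R_n = √ρ(√ρ + 1/(n+1))⁻¹ and correct the trace. Then g = Jψ is orthogonal to
ker J, and (g, J⁺g) = (ψ, JJ⁺Jψ) = (ψ, Jψ) = σ².

Unboundedness of A is handled by the bounded truncations A E(B), whose traces are integrals against
P, and by exhausting ℝ with [−n, n]. The spectral measure is given only through quadratic forms, so
the commutation and the value of ‖A E(B)x‖² are recovered by polarization. -/

namespace QMeas

/-! ### Hilbert–Schmidt and trace class operators -/

section TraceClass

variable {ι H : Type*} [NormedAddCommGroup H] [InnerProductSpace ℂ H] [CompleteSpace H]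

/-- `X` is a Hilbert–Schmidt operator. -/
def IsHS (b : HilbertBasis ι ℂ H) (X : H →L[ℂ] H) : Prop :=
  Summable fun i => ‖X (b i)‖ ^ 2

variable {b : HilbertBasis ι ℂ H}

/-- Douglas' lemma. -/
theorem exists_eq_mul_of_norm_le {S R : H →L[ℂ] H} (h : ∀ x, ‖S x‖ ≤ ‖R x‖) :
    ∃ W : H →L[ℂ] H, S = W * R := by
  let K : Submodule ℂ H := (LinearMap.range (R : H →ₗ[ℂ] H)).topologicalClosure
  have : CompleteSpace K :=
    (Submodule.isClosed_topologicalClosure _).completeSpace_coe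
  let e : H →ₗ[ℂ] K := LinearMap.codRestrict K (R : H →ₗ[ℂ] H)
    fun x => Submodule.le_topologicalClosure _ ⟨x, rfl⟩
  have he : DenseRange e := by
    intro y
    rw [Metric.mem_closure_iff]
    intro ε hε
    obtain ⟨_, ⟨x, rfl⟩, hx⟩ := Metric.mem_closure_iff.1 y.2 ε hε
    exact ⟨e x, ⟨x, rfl⟩, hx⟩
  -- `R x ↦ S x` is well defined and contractive on the range of `R`; it extends to the closure by
  -- continuity, and to `H` by precomposing with the orthogonal projection.
  let V : K →L[ℂ] H := LinearMap.extendOfNorm (S : H →ₗ[ℂ] H) e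
  have hV : ∀ x, V (e x) = S x := fun x =>
    LinearMap.extendOfNorm_eq he ⟨1, fun x => by simpa [e] using h x⟩ x
  refine ⟨V ∘L K.orthogonalProjectionOnto, ?_⟩
  ext x
  have : K.orthogonalProjectionOnto (R x) = e x :=
    Submodule.orthogonalProjectionOnto_mem_subspace_eq_self (e x)
  simp [this, hV]

theorem norm_abs_apply (T : H →L[ℂ] H) (x : H) : ‖CFC.abs T x‖ = ‖T x‖ := by
  have h : ContinuousLinearMap.adjoint (CFC.abs T) = CFC.abs T :=
    (CFC.abs_nonneg T).isSelfAdjoint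
  have h2 : (⟪CFC.abs T x, CFC.abs T x⟫_ℂ) = ⟪T x, T x⟫_ℂ := by
    rw [← ContinuousLinearMap.adjoint_inner_right, h, ← mul_apply_eq_comp,
      CFC.abs_mul_abs, ContinuousLinearMap.star_eq_adjoint, mul_apply_eq_comp,
      ContinuousLinearMap.adjoint_inner_right]
  rw [@norm_eq_sqrt_re_inner ℂ, h2, ← @norm_eq_sqrt_re_inner ℂ]

theorem hasSum_norm_inner_sq (b : HilbertBasis ι ℂ H) (x : H) :
    HasSum (fun j => ‖⟪b j, x⟫_ℂ‖ ^ 2) (‖x‖ ^ 2) := by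
  have h := Complex.hasSum_re (b.hasSum_inner_mul_inner x x)
  convert h using 1
  · ext j
    rw [← inner_conj_symm x (b j), ← Complex.normSq_eq_conj_mul_self, Complex.ofReal_re,
      Complex.normSq_eq_norm_sq]
  · rw [inner_self_eq_norm_sq_to_K]
    norm_cast

/-- Parseval in each `X (b i)`. The matrix form is symmetric in the two indices, which gives
stability under adjoints. -/
theorem isHS_iff {X : H →L[ℂ] H} :
    IsHS b X ↔ Summable fun p : ι × ι => ‖⟪b p.2, X (b p.1)⟫_ℂ‖ ^ 2 := by
  rw [summable_prod_of_nonneg (fun p => by positivity)]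
  have h : ∀ i, ∑' j, ‖⟪b j, X (b i)⟫_ℂ‖ ^ 2 = ‖X (b i)‖ ^ 2 := fun i =>
    (hasSum_norm_inner_sq b _).tsum_eq
  simp only [h]
  exact ⟨fun hX => ⟨fun i => (hasSum_norm_inner_sq b _).summable, hX⟩, fun hX => hX.2⟩

theorem IsHS.star {X : H →L[ℂ] H} (hX : IsHS b X) : IsHS b (star X) := by
  rw [isHS_iff] at hX ⊢
  refine ((Equiv.prodComm ι ι).summable_iff.2 hX).congr fun p => ?_
  simp only [Function.comp, Equiv.prodComm_apply, Prod.fst_swap, Prod.snd_swap]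
  rw [ContinuousLinearMap.star_eq_adjoint, ContinuousLinearMap.adjoint_inner_right,
    norm_inner_symm]

theorem IsHS.mul_left {X : H →L[ℂ] H} (hX : IsHS b X) (Z : H →L[ℂ] H) : IsHS b (Z * X) := by
  refine Summable.of_nonneg_of_le (fun i => by positivity) (fun i => ?_)
    (Summable.mul_left (‖Z‖ ^ 2) hX)
  rw [← mul_pow]
  exact pow_le_pow_left₀ (norm_nonneg _) (Z.le_opNorm _) 2

theorem IsHS.mul_right {X : H →L[ℂ] H} (hX : IsHS b X) (Z : H →L[ℂ] H) : IsHS b (X * Z) := by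
  have := (hX.star.mul_left (Star.star Z)).star
  simpa using this

theorem summable_norm_mul_norm {X Y : H →L[ℂ] H} (hX : IsHS b X) (hY : IsHS b Y) :
    Summable fun i => ‖X (b i)‖ * ‖Y (b i)‖ := by
  refine Summable.of_nonneg_of_le (fun i => by positivity) (fun i => ?_) (hX.add hY)
  nlinarith [sq_nonneg (‖X (b i)‖ - ‖Y (b i)‖), sq_nonneg (‖X (b i)‖), sq_nonneg (‖Y (b i)‖)]

theorem inner_mul_apply (X Y : H →L[ℂ] H) (x y : H) :
    ⟪x, (X * Y) y⟫_ℂ = ⟪(Star.star X) x, Y y⟫_ℂ := by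
  rw [ContinuousLinearMap.star_eq_adjoint, ContinuousLinearMap.adjoint_inner_left,
    mul_apply_eq_comp]

theorem summable_inner_mul {X Y : H →L[ℂ] H} (hX : IsHS b X) (hY : IsHS b Y) :
    Summable fun i => ⟪b i, (X * Y) (b i)⟫_ℂ := by
  refine Summable.of_norm_bounded (summable_norm_mul_norm hX.star hY) fun i => ?_
  rw [inner_mul_apply]
  exact norm_inner_le_norm _ _

theorem isHS_sqrt {S : H →L[ℂ] H} (hS : 0 ≤ S)
    (h : Summable fun i => (⟪b i, S (b i)⟫_ℂ).re) : IsHS b (CFC.sqrt S) := by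
  refine h.congr fun i => ?_
  have hs : star (CFC.sqrt S) = CFC.sqrt S := (CFC.sqrt_nonneg S).isSelfAdjoint
  have h1 : ⟪b i, S (b i)⟫_ℂ = ⟪CFC.sqrt S (b i), CFC.sqrt S (b i)⟫_ℂ := by
    conv_lhs => rw [← CFC.sqrt_mul_sqrt_self S hS]
    rw [inner_mul_apply, hs]
  rw [h1, inner_self_eq_norm_sq_to_K]
  norm_cast

/-- An operator is trace class iff it is a product of two Hilbert–Schmidt operators. -/
theorem isTraceClass_iff {T : H →L[ℂ] H} :
    IsTraceClass b T ↔ ∃ X Y, IsHS b X ∧ IsHS b Y ∧ T = X * Y := by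
  constructor
  · intro h
    have hs := isHS_sqrt (CFC.abs_nonneg T) h
    -- Douglas' lemma replaces the polar decomposition: `T = W |T|` here, and `|T| = W T` in the
    -- converse.
    obtain ⟨W, hW⟩ := exists_eq_mul_of_norm_le (S := T) (R := CFC.abs T)
      fun x => (norm_abs_apply T x).ge
    refine ⟨W * CFC.sqrt (CFC.abs T), CFC.sqrt (CFC.abs T), hs.mul_left W, hs, ?_⟩
    rw [mul_assoc, CFC.sqrt_mul_sqrt_self _ (CFC.abs_nonneg T), ← hW]
  · rintro ⟨X, Y, hX, hY, hT⟩
    obtain ⟨W, hW⟩ := exists_eq_mul_of_norm_le (S := CFC.abs T) (R := T)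
      fun x => (norm_abs_apply T x).le
    have := summable_inner_mul (hX.mul_left W) hY
    rw [mul_assoc, ← hT, ← hW] at this
    exact (Complex.hasSum_re this.hasSum).summable

theorem IsHS.isTraceClass_mul {X Y : H →L[ℂ] H} (hX : IsHS b X) (hY : IsHS b Y) :
    IsTraceClass b (X * Y) :=
  isTraceClass_iff.2 ⟨X, Y, hX, hY, rfl⟩

/-! ### The ideal and linear structure of the trace class -/

namespace IsTraceClass

variable {S T : H →L[ℂ] H}

theorem mul_left (hT : IsTraceClass b T) (Z : H →L[ℂ] H) : IsTraceClass b (Z * T) := by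
  obtain ⟨X, Y, hX, hY, rfl⟩ := isTraceClass_iff.1 hT
  rw [← mul_assoc]
  exact (hX.mul_left Z).isTraceClass_mul hY

theorem mul_right (hT : IsTraceClass b T) (Z : H →L[ℂ] H) : IsTraceClass b (T * Z) := by
  obtain ⟨X, Y, hX, hY, rfl⟩ := isTraceClass_iff.1 hT
  rw [mul_assoc]
  exact hX.isTraceClass_mul (hY.mul_right Z)

theorem star (hT : IsTraceClass b T) : IsTraceClass b (star T) := by
  obtain ⟨X, Y, hX, hY, rfl⟩ := isTraceClass_iff.1 hT
  rw [star_mul]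
  exact hY.star.isTraceClass_mul hX.star

theorem summable (hT : IsTraceClass b T) : Summable fun i => ⟪b i, T (b i)⟫_ℂ := by
  obtain ⟨X, Y, hX, hY, rfl⟩ := isTraceClass_iff.1 hT
  exact summable_inner_mul hX hY

/-- With `|S + T| = W (S + T)`, the diagonal series of `|S + T|` splits into those of `W S` and `W
T`. -/
theorem add (hS : IsTraceClass b S) (hT : IsTraceClass b T) : IsTraceClass b (S + T) := by
  obtain ⟨W, hW⟩ := exists_eq_mul_of_norm_le (S := CFC.abs (S + T)) (R := S + T)
      fun x => (norm_abs_apply _ x).le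
  have := (hS.mul_left W).summable.add (hT.mul_left W).summable
  refine (Complex.hasSum_re this.hasSum).summable.congr fun i => ?_
  rw [hW, mul_add, add_apply, inner_add_right]

theorem smul (hT : IsTraceClass b T) (c : ℂ) : IsTraceClass b (c • T) := by
  simpa using hT.mul_left (c • (1 : H →L[ℂ] H))

theorem smul_real (hT : IsTraceClass b T) (c : ℝ) : IsTraceClass b (c • T) := by
  simpa using hT.smul (c : ℂ)

theorem neg (hT : IsTraceClass b T) : IsTraceClass b (-T) := by
  simpa using hT.smul_real (-1)

theorem sub (hS : IsTraceClass b S) (hT : IsTraceClass b T) : IsTraceClass b (S - T) := by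
  simpa [sub_eq_add_neg] using hS.add hT.neg

theorem trace_add (hS : IsTraceClass b S) (hT : IsTraceClass b T) :
    trace b (S + T) = trace b S + trace b T := by
  simp only [trace, add_apply, inner_add_right]
  exact hS.summable.tsum_add hT.summable

theorem trace_sub (hS : IsTraceClass b S) (hT : IsTraceClass b T) :
    trace b (S - T) = trace b S - trace b T := by
  simp only [trace, sub_apply, inner_sub_right]
  exact hS.summable.tsum_sub hT.summable

end IsTraceClass

theorem trace_smul_real (c : ℝ) (T : H →L[ℂ] H) : trace b (c • T) = c * trace b T := by
  simp only [trace, smul_apply, inner_smul_right_eq_smul, Complex.real_smul,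
    tsum_mul_left]

theorem trace_star (T : H →L[ℂ] H) : trace b (star T) = star (trace b T) := by
  simp only [trace]
  rw [tsum_star]
  congr 1
  ext i
  rw [ContinuousLinearMap.star_eq_adjoint, ContinuousLinearMap.adjoint_inner_right]
  exact (inner_conj_symm _ _).symm

/-- Both traces are iterated sums of one double series of matrix entries, absolutely summable
because each factor has square-summable entries. -/
theorem IsHS.trace_mul_comm {X Y : H →L[ℂ] H} (hX : IsHS b X) (hY : IsHS b Y) :
    trace b (X * Y) = trace b (Y * X) := by
  let F : ι → ι → ℂ := fun i j => ⟪b i, X (b j)⟫_ℂ * ⟪b j, Y (b i)⟫_ℂ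
  have hF : Summable (Function.uncurry F) := by
    refine Summable.of_norm_bounded (((Equiv.prodComm ι ι).summable_iff.2 (isHS_iff.1 hX)).add
      (isHS_iff.1 hY)) fun p => ?_
    simp only [Function.uncurry, F, norm_mul, Function.comp, Equiv.prodComm_apply, Prod.fst_swap,
      Prod.snd_swap]
    nlinarith [sq_nonneg (‖⟪b p.1, X (b p.2)⟫_ℂ‖ - ‖⟪b p.2, Y (b p.1)⟫_ℂ‖),
      sq_nonneg (‖⟪b p.1, X (b p.2)⟫_ℂ‖), sq_nonneg (‖⟪b p.2, Y (b p.1)⟫_ℂ‖)]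
  have h1 : ∀ i, ∑' j, F i j = ⟪b i, (X * Y) (b i)⟫_ℂ := fun i => by
    rw [inner_mul_apply, ← b.tsum_inner_mul_inner]
    simp only [F, ContinuousLinearMap.star_eq_adjoint, ContinuousLinearMap.adjoint_inner_left]
  have h2 : ∀ j, ∑' i, F i j = ⟪b j, (Y * X) (b j)⟫_ℂ := fun j => by
    rw [inner_mul_apply, ← b.tsum_inner_mul_inner]
    simp only [F, ContinuousLinearMap.star_eq_adjoint, ContinuousLinearMap.adjoint_inner_left,
      mul_comm]
  simp only [trace, ← h1, ← h2]
  exact hF.tsum_comm.symm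

theorem IsTraceClass.trace_mul_comm {T : H →L[ℂ] H} (hT : IsTraceClass b T) (Z : H →L[ℂ] H) :
    trace b (T * Z) = trace b (Z * T) := by
  obtain ⟨X, Y, hX, hY, rfl⟩ := isTraceClass_iff.1 hT
  rw [mul_assoc, hX.trace_mul_comm (hY.mul_right Z), mul_assoc,
    hY.trace_mul_comm (hX.mul_left Z), mul_assoc]

/-- `Tr[T Rₙ] → Tr[T R]` if `T` is trace class and `Rₙ → R` weakly and boundedly. -/
theorem IsTraceClass.tendsto_trace_mul {T : H →L[ℂ] H} (hT : IsTraceClass b T)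
    {R : ℕ → H →L[ℂ] H} {R' : H →L[ℂ] H} {C : ℝ} (hC : ∀ n, ‖R n‖ ≤ C)
    (hR : ∀ x y, Filter.Tendsto (fun n => ⟪x, R n y⟫_ℂ) Filter.atTop (nhds ⟪x, R' y⟫_ℂ)) :
    Filter.Tendsto (fun n => trace b (T * R n)) Filter.atTop (nhds (trace b (T * R'))) := by
  obtain ⟨X, Y, hX, hY, rfl⟩ := isTraceClass_iff.1 hT
  -- Placing `Z` between the two Hilbert–Schmidt factors gives a summable bound depending only on
  -- the norm of `Z`.
  have key : ∀ Z : H →L[ℂ] H, trace b (X * Y * Z) = ∑' i, ⟪Star.star Y (b i), Z (X (b i))⟫_ℂ := by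
    intro Z
    rw [mul_assoc, hX.trace_mul_comm (hY.mul_right Z), mul_assoc, trace]
    congr 1
    ext i
    rw [inner_mul_apply Y, mul_apply_eq_comp]
  simp only [key]
  have hC0 : 0 ≤ C := (norm_nonneg _).trans (hC 0)
  refine tendsto_tsum_of_dominated_convergence
    ((summable_norm_mul_norm hY.star hX).mul_left C) (fun i => hR _ _)
    (Filter.Eventually.of_forall fun n i => ?_)
  calc ‖⟪Star.star Y (b i), R n (X (b i))⟫_ℂ‖ ≤ ‖Star.star Y (b i)‖ * ‖R n (X (b i))‖ :=
        norm_inner_le_norm _ _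
    _ ≤ ‖Star.star Y (b i)‖ * (C * ‖X (b i)‖) := by
        gcongr
        exact (R n).le_of_opNorm_le (hC n) _
    _ = C * (‖Star.star Y (b i)‖ * ‖X (b i)‖) := by ring

theorem IsTraceClass.abs {T : H →L[ℂ] H} (hT : IsTraceClass b T) :
    IsTraceClass b (CFC.abs T) := by
  rw [IsTraceClass, CFC.cfcAbs_cfcAbs]
  exact hT

theorem IsTraceClass.isHS_sqrt {S : H →L[ℂ] H} (hS : 0 ≤ S) (h : IsTraceClass b S) :
    IsHS b (CFC.sqrt S) :=
  QMeas.isHS_sqrt hS (Complex.hasSum_re h.summable.hasSum).summable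

/-- A self-adjoint trace class operator is a difference of positive ones. -/
theorem IsTraceClass.exists_eq_sub {T : H →L[ℂ] H} (hT : IsTraceClass b T)
    (hsa : IsSelfAdjoint T) :
    ∃ S R, 0 ≤ S ∧ 0 ≤ R ∧ IsTraceClass b S ∧ IsTraceClass b R ∧ T = S - R := by
  have h1 := CFC.abs_add_self T hsa
  have h2 := CFC.abs_sub_self T hsa
  have h1' : (T⁺ : H →L[ℂ] H) = (2⁻¹ : ℝ) • (CFC.abs T + T) := by rw [h1]; module
  have h2' : (T⁻ : H →L[ℂ] H) = (2⁻¹ : ℝ) • (CFC.abs T - T) := by rw [h2]; module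
  refine ⟨T⁺, T⁻, CFC.posPart_nonneg T, CFC.negPart_nonneg T, ?_, ?_,
    (CFC.posPart_sub_negPart T hsa).symm⟩
  · rw [h1']; exact (hT.abs.add hT).smul_real _
  · rw [h2']; exact (hT.abs.sub hT).smul_real _

end TraceClass

/-- Two finite measures whose difference has density `l` with respect to `P`. -/
theorem integral_sub_integral_of_density {Ω : Type*} [MeasurableSpace Ω] {μ₁ μ₂ P : Measure Ω}
    [IsFiniteMeasure μ₁] [IsFiniteMeasure μ₂] {l : Ω → ℝ} (hl : Integrable l P)
    (h : ∀ C, MeasurableSet C → μ₁.real C - μ₂.real C = ∫ x in C, l x ∂P)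
    {f : Ω → ℝ} (hf : Measurable f) {K : ℝ} (hK : ∀ x, |f x| ≤ K) :
    ∫ x, f x ∂μ₁ - ∫ x, f x ∂μ₂ = ∫ x, f x * l x ∂P := by
  -- The positive and negative parts of `l` turn the signed identity into an equality of finite
  -- positive measures, `μ₁ + ν₂ = μ₂ + ν₁`.
  let ν₁ := P.withDensity fun x => ENNReal.ofReal (l x)
  let ν₂ := P.withDensity fun x => ENNReal.ofReal (-l x)
  have : IsFiniteMeasure ν₁ := isFiniteMeasure_withDensity_ofReal hl.2
  have : IsFiniteMeasure ν₂ := isFiniteMeasure_withDensity_ofReal hl.neg.2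
  have hfi : ∀ (μ : Measure Ω) [IsFiniteMeasure μ], Integrable f μ := fun μ _ =>
    Integrable.of_bound hf.aestronglyMeasurable K (Filter.Eventually.of_forall hK)
  have hμ : μ₁ + ν₂ = μ₂ + ν₁ := by
    ext C hC
    rw [← ENNReal.toReal_eq_toReal_iff' (measure_ne_top _ _) (measure_ne_top _ _)]
    have := h C hC
    rw [integral_eq_lintegral_pos_part_sub_lintegral_neg_part hl.integrableOn] at this
    rw [Measure.add_apply, Measure.add_apply, ENNReal.toReal_add (by simp) (by simp),
      ENNReal.toReal_add (by simp) (by simp), withDensity_apply _ hC, withDensity_apply _ hC]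
    simp only [Measure.real] at this
    linarith
  have h1 : ∫ x, f x ∂ν₁ = ∫ x, max (l x) 0 * f x ∂P :=
    integral_withDensity_eq_integral_toReal_smul₀ hl.1.aemeasurable.ennreal_ofReal
      (by simp) f
  have h2 : ∫ x, f x ∂ν₂ = ∫ x, max (-l x) 0 * f x ∂P :=
    integral_withDensity_eq_integral_toReal_smul₀ hl.1.aemeasurable.neg.ennreal_ofReal
      (by simp) f
  have h3 := congrArg (fun μ => ∫ x, f x ∂μ) hμ
  simp only [integral_add_measure (hfi _) (hfi _)] at h3
  have h4 : ∫ x, f x * l x ∂P = ∫ x, max (l x) 0 * f x ∂P - ∫ x, max (-l x) 0 * f x ∂P := by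
    have hs := integral_sub (hl.pos_part.mul_bdd (c := K) hf.aestronglyMeasurable
      (Filter.Eventually.of_forall hK)) (hl.neg.pos_part.mul_bdd (c := K) hf.aestronglyMeasurable
      (Filter.Eventually.of_forall hK))
    simp only [Pi.neg_apply] at hs
    rw [← hs]
    refine integral_congr_ae (Filter.Eventually.of_forall fun x => ?_)
    have := max_zero_sub_eq_self (l x)
    simp only [max_comm _ (0 : ℝ), ← sub_mul] at this ⊢
    rw [this, mul_comm]
  rw [h4, ← h1, ← h2]
  linarith

/-! ### Positive operator-valued measures -/

namespace POVM

variable {Ω H : Type*} [MeasurableSpace Ω]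
  [NormedAddCommGroup H] [InnerProductSpace ℂ H] [CompleteSpace H]
  (M : POVM Ω H) {B C : Set Ω}

theorem star_effect (hB : MeasurableSet B) : star (M.effect B) = M.effect B :=
  (M.isPositive B hB).isSelfAdjoint

theorem inner_effect_left (hB : MeasurableSet B) (x y : H) :
    ⟪M.effect B x, y⟫_ℂ = ⟪x, M.effect B y⟫_ℂ :=
  (M.isPositive B hB).isSymmetric x y

theorem diag_apply (x : H) (hB : MeasurableSet B) :
    M.diag x B = ENNReal.ofReal (⟪x, M.effect B x⟫_ℂ).re :=
  Measure.ofMeasurable_apply B hB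

instance (x : H) : IsFiniteMeasure (M.diag x) :=
  ⟨by rw [M.diag_apply x MeasurableSet.univ]; exact ENNReal.ofReal_lt_top⟩

theorem diag_real (x : H) (hB : MeasurableSet B) :
    (M.diag x).real B = (⟪x, M.effect B x⟫_ℂ).re := by
  rw [Measure.real, M.diag_apply x hB]
  exact ENNReal.toReal_ofReal ((M.isPositive B hB).re_inner_nonneg_right x)

theorem inner_effect_self (x : H) (hB : MeasurableSet B) :
    ⟪x, M.effect B x⟫_ℂ = ((M.diag x).real B : ℂ) := by
  rw [M.diag_real x hB]
  apply Complex.ext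
  · simp
  · rw [Complex.ofReal_im]
    have := congrArg Complex.im (inner_conj_symm x (M.effect B x))
    rw [M.inner_effect_left hB, Complex.conj_im] at this
    linarith

/-- On a complex space an operator is determined by its quadratic form, and the quadratic forms of
the effects are measures. -/
theorem effect_union (hB : MeasurableSet B) (hC : MeasurableSet C) (h : Disjoint B C) :
    M.effect (B ∪ C) = M.effect B + M.effect C := by
  have : ((M.effect (B ∪ C) : H →L[ℂ] H) : H →ₗ[ℂ] H)
      = ((M.effect B + M.effect C : H →L[ℂ] H) : H →ₗ[ℂ] H) := by
    rw [← ext_inner_map]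
    intro x
    simp only [ContinuousLinearMap.coe_coe, add_apply, inner_add_left,
      M.inner_effect_left hB, M.inner_effect_left hC, M.inner_effect_left (hB.union hC),
      M.inner_effect_self x hB, M.inner_effect_self x hC, M.inner_effect_self x (hB.union hC)]
    rw [measureReal_union h hC]
    push_cast
    rfl
  exact ContinuousLinearMap.coe_injective this

theorem effect_add_compl (hB : MeasurableSet B) : M.effect B + M.effect Bᶜ = 1 := by
  rw [← M.effect_union hB hB.compl disjoint_compl_right, Set.union_compl_self, M.effect_univ]

theorem norm_effect_le (hM : M.IsPVM) (hB : MeasurableSet B) : ‖M.effect B‖ ≤ 1 := by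
  have h := CStarRing.norm_star_mul_self (x := M.effect B)
  rw [M.star_effect hB, hM B hB] at h
  by_contra! h1
  nlinarith

variable {M}

/-- If P, Q and P + Q are idempotent, then PQ + QP = 0. Multiplying by P on the left gives PQ + PQP
= 0, then on the right 2PQP = 0, so PQ = 0. -/
theorem IsPVM.mul_eq_zero (hM : M.IsPVM) (hB : MeasurableSet B) (hC : MeasurableSet C)
    (h : Disjoint B C) : M.effect B * M.effect C = 0 := by
  have h1 := hM _ (hB.union hC)
  have hB2 := hM B hB
  have hC2 := hM C hC
  rw [M.effect_union hB hC h, mul_add, add_mul, add_mul, hB2, hC2] at h1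
  have h2 : M.effect B * M.effect C + M.effect C * M.effect B = 0 := by
    have : M.effect B * M.effect C + M.effect C * M.effect B
      = (M.effect B + M.effect C * M.effect B + (M.effect B * M.effect C + M.effect C))
        - (M.effect B + M.effect C) := by abel
    rw [this, h1, sub_self]
  have h3 : M.effect B * M.effect C + M.effect B * M.effect C * M.effect B = 0 := by
    have := congrArg (M.effect B * ·) h2
    simpa only [mul_add, ← mul_assoc, hB2, mul_zero] using this
  have h4 : M.effect B * M.effect C * M.effect B = 0 := by
    have := congrArg (· * M.effect B) h3
    simp only [add_mul, mul_assoc, hB2, zero_mul] at this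
    rw [← two_smul ℂ] at this
    rw [mul_assoc]
    exact (smul_eq_zero.1 this).resolve_left two_ne_zero
  rwa [h4, add_zero] at h3

theorem IsPVM.effect_empty (hM : M.IsPVM) : M.effect ∅ = 0 := by
  rw [← hM ∅ MeasurableSet.empty,
    hM.mul_eq_zero MeasurableSet.empty MeasurableSet.empty (Set.disjoint_empty _)]

theorem IsPVM.mul_eq (hM : M.IsPVM) (hB : MeasurableSet B) (hC : MeasurableSet C) :
    M.effect B * M.effect C = M.effect (B ∩ C) := by
  have h1 : M.effect B = M.effect (B ∩ C) + M.effect (B \ C) := by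
    rw [← M.effect_union (hB.inter hC) (hB.diff hC) Set.disjoint_sdiff_inter.symm,
      Set.inter_union_sdiff]
  have h2 : M.effect C = M.effect (B ∩ C) + M.effect (C \ B) := by
    rw [Set.inter_comm, ← M.effect_union (hC.inter hB) (hC.diff hB) Set.disjoint_sdiff_inter.symm,
      Set.inter_union_sdiff]
  rw [h1, h2, mul_add, add_mul, add_mul, hM _ (hB.inter hC),
    hM.mul_eq_zero (hB.diff hC) (hB.inter hC) Set.disjoint_sdiff_inter,
    hM.mul_eq_zero (hB.inter hC) (hC.diff hB)
      (Set.disjoint_left.2 fun x hx hx' => hx'.2 hx.1),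
    hM.mul_eq_zero (hB.diff hC) (hC.diff hB)
      (Set.disjoint_left.2 fun x hx hx' => hx'.2 hx.1)]
  simp

theorem IsPVM.apply_apply (hM : M.IsPVM) (hB : MeasurableSet B) (hC : MeasurableSet C) (x : H) :
    M.effect B (M.effect C x) = M.effect (B ∩ C) x := by
  rw [← hM.mul_eq hB hC, mul_apply_eq_comp]

theorem IsPVM.diag_effect (hM : M.IsPVM) (hB : MeasurableSet B) (x : H) :
    M.diag (M.effect B x) = (M.diag x).restrict B := by
  ext C hC
  rw [M.diag_apply _ hC, Measure.restrict_apply hC, M.diag_apply _ (hC.inter hB),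
    M.inner_effect_left hB, hM.apply_apply hC hB, hM.apply_apply hB (hC.inter hB),
    Set.inter_eq_right.2 Set.inter_subset_right]

/-- The cross terms ⟨x, E(D)y⟩ vanish because E(B)E(D)E(C) = E(B ∩ D ∩ C) = 0. -/
theorem IsPVM.diag_add (hM : M.IsPVM) (hB : MeasurableSet B) (hC : MeasurableSet C)
    (h : Disjoint B C) {x y : H} (hx : M.effect B x = x) (hy : M.effect C y = y) :
    M.diag (x + y) = M.diag x + M.diag y := by
  have hxy : ∀ D, MeasurableSet D → ⟪x, M.effect D y⟫_ℂ = 0 := fun D hD => by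
    rw [← hx, ← hy, M.inner_effect_left hB, hM.apply_apply hD hC, hM.apply_apply hB (hD.inter hC),
      Set.inter_comm D, ← Set.inter_assoc, h.inter_eq, Set.empty_inter, hM.effect_empty]
    simp
  ext D hD
  rw [Measure.add_apply, ← ENNReal.toReal_eq_toReal_iff' (by simp) (by simp),
    ENNReal.toReal_add (by simp) (by simp)]
  change (M.diag (x + y)).real D = (M.diag x).real D + (M.diag y).real D
  rw [M.diag_real _ hD, M.diag_real _ hD, M.diag_real _ hD, map_add, inner_add_left,
    inner_add_right, inner_add_right, hxy D hD, ← M.inner_effect_left hD y x,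
    ← inner_conj_symm (M.effect D y), hxy D hD]
  simp

end POVM

/-! ### The spectral measure of a self-adjoint operator -/

theorem symmetric_apply {H : Type*} [NormedAddCommGroup H] [InnerProductSpace ℂ H]
    [CompleteSpace H] {A : H →ₗ.[ℂ] H} (hA : IsSelfAdjoint A) (x y : A.domain) :
    ⟪A x, (y : H)⟫_ℂ = ⟪(x : H), A y⟫_ℂ := by
  have h := LinearPMap.adjoint_isFormalAdjoint hA.dense_domain
  rw [LinearPMap.isSelfAdjoint_def.1 hA] at h
  exact h x y

namespace IsSpectralMeasure

variable {H : Type*} [NormedAddCommGroup H] [InnerProductSpace ℂ H] [CompleteSpace H]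
  {E : POVM ℝ H} {A : H →ₗ.[ℂ] H} {B C : Set ℝ}

theorem effect_mem_domain (hE : IsSpectralMeasure E A) (hB : MeasurableSet B) {x : H}
    (hx : x ∈ A.domain) : E.effect B x ∈ A.domain := by
  rw [hE.mem_domain_iff] at hx ⊢
  rw [hE.isPVM.diag_effect hB]
  exact hx.integrableOn

theorem effect_mem_domain_of_isBounded (hE : IsSpectralMeasure E A) (hB : MeasurableSet B)
    (hb : Bornology.IsBounded B) (x : H) : E.effect B x ∈ A.domain := by
  rw [hE.mem_domain_iff, hE.isPVM.diag_effect hB]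
  obtain ⟨R, hR⟩ := hb.exists_norm_le
  refine Integrable.of_bound (by fun_prop) (R ^ 2) ?_
  filter_upwards [ae_restrict_mem hB] with t ht
  rw [norm_pow]
  exact pow_le_pow_left₀ (norm_nonneg _) (hR t ht) 2

/-- Only the quadratic form of `A` is prescribed. Additivity of the diagonal measures on `x + y`
gives ⟨x, Ay⟩ + ⟨y, Ax⟩ = 0; replacing y by iy gives ⟨x, Ay⟩ = ⟨y, Ax⟩, so both vanish. -/
theorem inner_apply_eq_zero (hE : IsSpectralMeasure E A) (hB : MeasurableSet B)
    (hC : MeasurableSet C) (h : Disjoint B C) {x y : A.domain}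
    (hx : E.effect B (x : H) = x) (hy : E.effect C (y : H) = y) : ⟪(x : H), A y⟫_ℂ = 0 := by
  have key : ∀ y : A.domain, E.effect C (y : H) = y →
      ⟪(x : H), A y⟫_ℂ + ⟪(y : H), A x⟫_ℂ = 0 := fun y hy => by
    have h1 := hE.inner_apply (x + y)
    have hd : E.diag ((x + y : A.domain) : H) = E.diag (x : H) + E.diag (y : H) :=
      hE.isPVM.diag_add hB hC h hx hy
    have hint : ∀ z : A.domain, Integrable (fun t : ℝ => t) (E.diag (z : H)) := fun z => by
      have := (hE.mem_domain_iff z).1 z.2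
      refine (this.add (integrable_const 1)).mono' (by fun_prop) ?_
      refine Filter.Eventually.of_forall fun t => ?_
      simp only [Pi.add_apply, Real.norm_eq_abs]
      nlinarith [sq_abs t, sq_nonneg (|t| - 1)]
    rw [hd, integral_add_measure (hint x) (hint y), Complex.ofReal_add, ← hE.inner_apply x,
      ← hE.inner_apply y, LinearPMap.map_add, Submodule.coe_add, inner_add_left, inner_add_right,
      inner_add_right] at h1
    linear_combination h1
  have h1 := key y hy
  have h2 := key (Complex.I • y) (by rw [Submodule.coe_smul, map_smul, hy])
  rw [LinearPMap.map_smul, Submodule.coe_smul, inner_smul_left, inner_smul_right, Complex.conj_I] at h2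
  have h3 : ⟪(x : H), A y⟫_ℂ = ⟪(y : H), A x⟫_ℂ := by
    have : Complex.I * (⟪(x : H), A y⟫_ℂ - ⟪(y : H), A x⟫_ℂ) = 0 := by linear_combination h2
    exact sub_eq_zero.1 ((mul_eq_zero.1 this).resolve_left Complex.I_ne_zero)
  have : (2 : ℂ) * ⟪(x : H), A y⟫_ℂ = 0 := by linear_combination h1 + h3
  exact (mul_eq_zero.1 this).resolve_left two_ne_zero

theorem inner_effect_apply (hE : IsSpectralMeasure E A) (hB : MeasurableSet B) (y x : A.domain) :
    ⟪E.effect B (y : H), A x⟫_ℂ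
      = ⟪E.effect B (y : H), A ⟨E.effect B x, hE.effect_mem_domain hB x.2⟩⟫_ℂ := by
  have h : x = ⟨E.effect B x, hE.effect_mem_domain hB x.2⟩
      + ⟨E.effect Bᶜ x, hE.effect_mem_domain hB.compl x.2⟩ := by
    ext
    have := congrArg (· (x : H)) (E.effect_add_compl hB)
    simpa using this.symm
  conv_lhs => rw [h, LinearPMap.map_add, inner_add_right]
  rw [hE.inner_apply_eq_zero hB hB.compl disjoint_compl_right
    (x := ⟨E.effect B y, hE.effect_mem_domain hB y.2⟩)
    (y := ⟨E.effect Bᶜ x, hE.effect_mem_domain hB.compl x.2⟩), add_zero]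
  · simp [hE.isPVM.apply_apply hB hB]
  · simp [hE.isPVM.apply_apply hB.compl hB.compl]

/-- The spectral projections commute with `A`. -/
theorem apply_effect (hE : IsSpectralMeasure E A) (hA : IsSelfAdjoint A) (hB : MeasurableSet B)
    (x : A.domain) : A ⟨E.effect B x, hE.effect_mem_domain hB x.2⟩ = E.effect B (A x) := by
  refine hA.dense_domain.eq_of_inner_right (𝕜 := ℂ) fun y hy => ?_
  have h := hE.inner_effect_apply hB ⟨y, hy⟩ x
  rw [← E.inner_effect_left hB, h]
  have hy' : y = E.effect B y + E.effect Bᶜ y := by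
    have := congrArg (· y) (E.effect_add_compl hB)
    simpa using this.symm
  conv_lhs => rw [hy', inner_add_left]
  rw [hE.inner_apply_eq_zero hB.compl hB disjoint_compl_left
    (x := ⟨E.effect Bᶜ y, hE.effect_mem_domain hB.compl hy⟩), add_zero]
  · simp [hE.isPVM.apply_apply hB.compl hB.compl]
  · simp [hE.isPVM.apply_apply hB hB]

/-- The bounded operator `A E(B)`, for a bounded set `B`. -/
def IsTruncation (E : POVM ℝ H) (A : H →ₗ.[ℂ] H) (B : Set ℝ) (S : H →L[ℂ] H) : Prop :=
  ∀ x, ∃ h : E.effect B x ∈ A.domain, S x = A ⟨E.effect B x, h⟩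

/-- `A E(B)` is everywhere defined because `B` is bounded, and symmetric because `A` commutes with
E(B); Hellinger–Toeplitz makes it bounded. -/
theorem exists_isTruncation (hE : IsSpectralMeasure E A) (hA : IsSelfAdjoint A)
    (hB : MeasurableSet B) (hb : Bornology.IsBounded B) :
    ∃ S : H →L[ℂ] H, IsTruncation E A B S := by
  let P : H →ₗ[ℂ] A.domain := LinearMap.codRestrict A.domain (E.effect B : H →ₗ[ℂ] H)
    (hE.effect_mem_domain_of_isBounded hB hb)
  let S : H →ₗ[ℂ] H := A.toFun ∘ₗ P
  have hPP : ∀ x, E.effect B (P x : H) = P x := fun x => by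
    simp [P, hE.isPVM.apply_apply hB hB]
  have hS : ∀ x, E.effect B (S x) = S x := fun x => by
    change E.effect B (A (P x)) = A (P x)
    rw [← hE.apply_effect hA hB]
    congr 1
    exact Subtype.ext (hPP x)
  have hsymm : S.IsSymmetric := fun x y => by
    rw [← hS x, ← hS y, E.inner_effect_left hB, ← E.inner_effect_left hB x]
    exact symmetric_apply hA (P x) (P y)
  exact ⟨⟨S, hsymm.continuous⟩, fun x => ⟨hE.effect_mem_domain_of_isBounded hB hb x, rfl⟩⟩

/-! ### Spectral calculus for the bounded truncations -/

namespace IsTruncation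

variable {S : H →L[ℂ] H}

theorem effect_apply (hS : IsTruncation E A B S) (hE : IsSpectralMeasure E A)
    (hA : IsSelfAdjoint A) (hB : MeasurableSet B) (x : H) : E.effect B (S x) = S x := by
  obtain ⟨h, hx⟩ := hS x
  rw [hx, ← hE.apply_effect hA hB]
  congr 1
  exact Subtype.ext (hE.isPVM.apply_apply hB hB x |>.trans (by rw [Set.inter_self]))

theorem isSelfAdjoint (hS : IsTruncation E A B S) (hE : IsSpectralMeasure E A)
    (hA : IsSelfAdjoint A) (hB : MeasurableSet B) : IsSelfAdjoint S := by
  rw [ContinuousLinearMap.isSelfAdjoint_iff_isSymmetric]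
  intro x y
  obtain ⟨h, hx⟩ := hS x
  obtain ⟨h', hy⟩ := hS y
  change ⟪S x, y⟫_ℂ = ⟪x, S y⟫_ℂ
  rw [← hS.effect_apply hE hA hB x, ← hS.effect_apply hE hA hB y, E.inner_effect_left hB,
    ← E.inner_effect_left hB x, hx, hy]
  exact symmetric_apply hA ⟨_, h⟩ ⟨_, h'⟩

theorem mul_effect (hS : IsTruncation E A B S) (hE : IsSpectralMeasure E A)
    (hA : IsSelfAdjoint A) (hB : MeasurableSet B) (hC : MeasurableSet C) :
    IsTruncation E A (B ∩ C) (E.effect C * S) := by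
  intro x
  obtain ⟨h, hx⟩ := hS x
  have h2 : E.effect (B ∩ C) x = E.effect C (E.effect B x) := by
    rw [hE.isPVM.apply_apply hC hB, Set.inter_comm]
  refine ⟨h2 ▸ hE.effect_mem_domain hC h, ?_⟩
  rw [mul_apply_eq_comp, hx, ← hE.apply_effect hA hC]
  congr 1
  exact Subtype.ext h2.symm

theorem inner_self (hS : IsTruncation E A B S) (hE : IsSpectralMeasure E A)
    (hA : IsSelfAdjoint A) (hB : MeasurableSet B) (x : H) :
    ⟪x, S x⟫_ℂ = ((∫ t in B, t ∂(E.diag x) : ℝ) : ℂ) := by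
  obtain ⟨h, hx⟩ := hS x
  rw [← hS.effect_apply hE hA hB, ← E.inner_effect_left hB, hx, ← hE.isPVM.diag_effect hB]
  exact hE.inner_apply ⟨_, h⟩

/-- By polarization, the diagonal measures of x + Sx and x − Sx differ by the density 4t·1_B with
respect to that of x. Integrating t·1_B against this difference gives 4‖Sx‖² on one side and 4∫_B t²
on the other. -/
theorem norm_sq (hS : IsTruncation E A B S) (hE : IsSpectralMeasure E A)
    (hA : IsSelfAdjoint A) (hB : MeasurableSet B) (hb : Bornology.IsBounded B) (x : H) :
    ‖S x‖ ^ 2 = ∫ t in B, t ^ 2 ∂(E.diag x) := by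
  obtain ⟨R, hR⟩ := hb.exists_norm_le
  have hbd : ∀ t, |B.indicator id t| ≤ max R 0 := fun t => by
    by_cases ht : t ∈ B
    · simpa [ht] using Or.inl (hR t ht)
    · simp [ht]
  have hmeas : Measurable (B.indicator (id : ℝ → ℝ)) := measurable_id.indicator hB
  have hint : Integrable (B.indicator (id : ℝ → ℝ)) (E.diag x) :=
    Integrable.of_bound hmeas.aestronglyMeasurable _ (Filter.Eventually.of_forall hbd)
  have hself := hS.isSelfAdjoint hE hA hB
  have hsymm : ∀ y z, ⟪S y, z⟫_ℂ = ⟪y, S z⟫_ℂ :=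
    ContinuousLinearMap.isSelfAdjoint_iff_isSymmetric.1 hself
  have hre : ∀ y, (⟪y, S y⟫_ℂ).re = ∫ t, B.indicator id t ∂(E.diag y) := fun y => by
    rw [hS.inner_self hE hA hB, Complex.ofReal_re, integral_indicator hB]
    rfl
  have hdiff : ∀ C, MeasurableSet C →
      (E.diag (x + S x)).real C - (E.diag (x - S x)).real C
        = ∫ t in C, 4 * B.indicator id t ∂(E.diag x) := fun C hC => by
    have h1 := (hS.mul_effect hE hA hB hC).inner_self hE hA (hB.inter hC) x
    have h2 : ⟪S x, E.effect C x⟫_ℂ = ⟪x, E.effect C (S x)⟫_ℂ := by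
      rw [mul_apply_eq_comp] at h1
      rw [← E.inner_effect_left hC, ← inner_conj_symm, h1, Complex.conj_ofReal]
    rw [E.diag_real _ hC, E.diag_real _ hC, integral_const_mul, integral_indicator hB,
      Measure.restrict_restrict hB]
    simp only [map_add, map_sub, inner_add_left, inner_sub_left, inner_add_right, inner_sub_right,
      h2]
    rw [mul_apply_eq_comp] at h1
    rw [h1]
    simp only [Complex.add_re, Complex.sub_re, Complex.ofReal_re, id]
    ring
  have h := integral_sub_integral_of_density (hint.const_mul 4) hdiff hmeas hbd
  rw [← hre, ← hre] at h
  simp only [map_add, map_sub, inner_add_left, inner_sub_left, inner_add_right, inner_sub_right,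
    Complex.add_re, Complex.sub_re, ← hsymm x] at h
  rw [inner_self_eq_norm_sq_to_K (𝕜 := ℂ)] at h
  have h5 : (((‖S x‖ : ℂ)) ^ 2).re = ‖S x‖ ^ 2 := by norm_cast
  have h6 : ∫ t, B.indicator id t * (4 * B.indicator id t) ∂(E.diag x)
      = 4 * ∫ t in B, t ^ 2 ∂(E.diag x) := by
    rw [← integral_indicator hB, ← integral_const_mul]
    congr 1
    ext t
    by_cases ht : t ∈ B <;> simp [ht]
    ring
  rw [h6] at h
  simp only [Complex.coe_algebraMap, h5] at h
  linarith

end IsTruncation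

end IsSpectralMeasure

/-! ### Outcome distributions -/

section Law

variable {ι Ω H : Type*} [MeasurableSpace Ω]
  [NormedAddCommGroup H] [InnerProductSpace ℂ H] [CompleteSpace H]
  {b : HilbertBasis ι ℂ H} {S : H →L[ℂ] H}

/-- Cyclicity moves one factor √S to the other side of Z. Traces thereby become sums of quadratic
forms, so that `law` is a sum of diagonal measures. -/
theorem hasSum_trace_mul (hS : 0 ≤ S) (hT : IsTraceClass b S) (Z : H →L[ℂ] H) :
    HasSum (fun i => ⟪CFC.sqrt S (b i), Z (CFC.sqrt S (b i))⟫_ℂ) (trace b (S * Z)) := by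
  have hs := hT.isHS_sqrt hS
  have hst : star (CFC.sqrt S) = CFC.sqrt S := (CFC.sqrt_nonneg S).isSelfAdjoint
  have h1 : trace b (S * Z) = trace b (CFC.sqrt S * (Z * CFC.sqrt S)) := by
    conv_lhs => rw [← CFC.sqrt_mul_sqrt_self S hS]
    rw [mul_assoc, hs.trace_mul_comm (hs.mul_right Z), mul_assoc]
  rw [h1]
  have h2 : HasSum _ (trace b (CFC.sqrt S * (Z * CFC.sqrt S))) :=
    (summable_inner_mul hs (hs.mul_left Z)).hasSum
  convert h2 using 2 with i
  rw [inner_mul_apply (CFC.sqrt S), hst, mul_apply_eq_comp]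

/-- The measure `B ↦ Tr[S M(B)]`, for a positive trace class operator `S`. -/
noncomputable def law (b : HilbertBasis ι ℂ H) (S : H →L[ℂ] H) (M : POVM Ω H) : Measure Ω :=
  Measure.sum fun i => M.diag (CFC.sqrt S (b i))

theorem law_apply (hS : 0 ≤ S) (hT : IsTraceClass b S) (M : POVM Ω H) {B : Set Ω}
    (hB : MeasurableSet B) : law b S M B = ENNReal.ofReal (trace b (S * M.effect B)).re := by
  have h := Complex.hasSum_re (hasSum_trace_mul hS hT (M.effect B))
  rw [law, Measure.sum_apply _ hB, ← h.tsum_eq, ENNReal.ofReal_tsum_of_nonneg _ h.summable]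
  · simp only [M.diag_apply _ hB]
  · exact fun i => (M.isPositive B hB).re_inner_nonneg_right _

theorem isFiniteMeasure_law (hS : 0 ≤ S) (hT : IsTraceClass b S) (M : POVM Ω H) :
    IsFiniteMeasure (law b S M) :=
  ⟨by rw [law_apply hS hT M MeasurableSet.univ]; exact ENNReal.ofReal_lt_top⟩

theorem law_real (hS : 0 ≤ S) (hT : IsTraceClass b S) (M : POVM Ω H) {B : Set Ω}
    (hB : MeasurableSet B) : (law b S M).real B = (trace b (S * M.effect B)).re := by
  have h := Complex.hasSum_re (hasSum_trace_mul hS hT (M.effect B))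
  rw [Measure.real, law_apply hS hT M hB, ENNReal.toReal_ofReal]
  rw [← h.tsum_eq]
  exact tsum_nonneg fun i => (M.isPositive B hB).re_inner_nonneg_right _

theorem IsDensity.nonneg (hS : IsDensity b S) : 0 ≤ S :=
  (ContinuousLinearMap.nonneg_iff_isPositive S).2 hS.isPositive

theorem outcomeLaw_spec (hS : IsDensity b S) (M : POVM Ω H) :
    IsProbabilityMeasure (outcomeLaw b S M) ∧ ∀ B, MeasurableSet B →
      (outcomeLaw b S M).real B = (trace b (S * M.effect B)).re := by
  refine Classical.epsilon_spec (p := fun P : Measure Ω => IsProbabilityMeasure P ∧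
    ∀ B, MeasurableSet B → P.real B = (trace b (S * M.effect B)).re) ⟨law b S M, ⟨?_⟩, fun B hB =>
      law_real hS.nonneg hS.traceClass M hB⟩
  rw [law_apply hS.nonneg hS.traceClass M MeasurableSet.univ, M.effect_univ, mul_one,
    hS.trace_eq_one]
  simp

theorem outcomeLaw_eq_law (hS : IsDensity b S) (M : POVM Ω H) :
    outcomeLaw b S M = law b S M := by
  have := (outcomeLaw_spec hS M).1
  have := isFiniteMeasure_law hS.nonneg hS.traceClass M
  ext B hB
  rw [← ENNReal.toReal_eq_toReal_iff' (by simp) (by simp)]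
  exact ((outcomeLaw_spec hS M).2 B hB).trans (law_real hS.nonneg hS.traceClass M hB).symm

/-- A strictly positive state is faithful: outcome probability zero gives E(B)√S = 0, hence S E(B) =
0, and S is injective. This is the source of absolute continuity in `exists_isLogDeriv`. -/
theorem effect_eq_zero_of_outcomeLaw (hS : IsDensity b S) (hpos : IsStrictlyPositiveOp S)
    {M : POVM Ω H} (hM : M.IsPVM) {B : Set Ω} (hB : MeasurableSet B)
    (h : outcomeLaw b S M B = 0) : M.effect B = 0 := by
  rw [outcomeLaw_eq_law hS, law, Measure.sum_apply_eq_zero' hB] at h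
  have h1 : ∀ i, M.effect B (CFC.sqrt S (b i)) = 0 := fun i => by
    have h2 := h i
    rw [M.diag_apply _ hB, ENNReal.ofReal_eq_zero] at h2
    have h3 := M.inner_effect_left hB (CFC.sqrt S (b i)) (M.effect B (CFC.sqrt S (b i)))
    rw [hM.apply_apply hB hB, Set.inter_self] at h3
    rw [← h3] at h2
    rw [← RCLike.re_eq_complex_re, inner_self_eq_norm_sq] at h2
    exact norm_eq_zero.1 (pow_eq_zero_iff two_ne_zero |>.1 (le_antisymm h2 (sq_nonneg _)))
  have h2 : M.effect B * CFC.sqrt S = 0 := by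
    refine ContinuousLinearMap.ext_on (s := Set.range b) ?_ ?_
    · have := b.dense_span
      rw [Submodule.dense_iff_topologicalClosure_eq_top]
      exact this
    · rintro _ ⟨i, rfl⟩
      simpa using h1 i
  have h3 : S * M.effect B = 0 := by
    have h4 := congrArg star h2
    rw [star_mul, M.star_effect hB, star_zero,
      show star (CFC.sqrt S) = CFC.sqrt S from (CFC.sqrt_nonneg S).isSelfAdjoint] at h4
    rw [← CFC.sqrt_mul_sqrt_self S hS.nonneg, mul_assoc, h4, mul_zero]
  ext x
  by_contra hx
  have h4 := hpos.2 _ hx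
  rw [← mul_apply_eq_comp, h3] at h4
  simp at h4

/-- In a strictly positive state, logarithmic derivatives always exist. -/
theorem exists_isLogDeriv (hS : IsDensity b S) (hpos : IsStrictlyPositiveOp S)
    {M : POVM Ω H} (hM : M.IsPVM) {φ : H →L[ℂ] H} (hφ : IsTraceClass b φ)
    (hsa : IsSelfAdjoint φ) : ∃ l, IsLogDeriv b S M φ l := by
  obtain ⟨F, G, hF, hG, hF', hG', rfl⟩ := hφ.exists_eq_sub hsa
  have := (outcomeLaw_spec hS M).1
  have := isFiniteMeasure_law hF hF' M
  have := isFiniteMeasure_law hG hG' M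
  have hac : ∀ F : H →L[ℂ] H, 0 ≤ F → IsTraceClass b F → law b F M ≪ outcomeLaw b S M :=
    fun F hF hF' => Measure.AbsolutelyContinuous.mk fun B hB h => by
      rw [law_apply hF hF' M hB, effect_eq_zero_of_outcomeLaw hS hpos hM hB h]
      simp [trace]
  refine ⟨fun x => ((law b F M).rnDeriv (outcomeLaw b S M) x).toReal
    - ((law b G M).rnDeriv (outcomeLaw b S M) x).toReal,
    Measure.integrable_toReal_rnDeriv.sub Measure.integrable_toReal_rnDeriv, fun B hB => ?_⟩
  rw [integral_sub Measure.integrable_toReal_rnDeriv.integrableOn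
    Measure.integrable_toReal_rnDeriv.integrableOn,
    Measure.setIntegral_toReal_rnDeriv (hac F hF hF'),
    Measure.setIntegral_toReal_rnDeriv (hac G hG hG'), law_real hF hF' M hB, law_real hG hG' M hB,
    sub_mul, (hF'.mul_right _).trace_sub (hG'.mul_right _), Complex.sub_re]

theorem isLogDeriv_logDeriv (hS : IsDensity b S) (hpos : IsStrictlyPositiveOp S)
    {M : POVM Ω H} (hM : M.IsPVM) {φ : H →L[ℂ] H} (hφ : IsTangent b φ) :
    IsLogDeriv b S M φ (logDeriv b S M φ) :=
  Classical.epsilon_spec (exists_isLogDeriv hS hpos hM hφ.traceClass hφ.isSelfAdjoint)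

/-- Densities are unique up to null sets, so any explicit density may replace the chosen one. -/
theorem IsLogDeriv.ae_eq_logDeriv {M : POVM Ω H} {φ : H →L[ℂ] H} {l : Ω → ℝ}
    (hl : IsLogDeriv b S M φ l) : logDeriv b S M φ =ᵐ[outcomeLaw b S M] l := by
  have h : IsLogDeriv b S M φ (logDeriv b S M φ) := Classical.epsilon_spec ⟨l, hl⟩
  exact h.1.ae_eq_of_forall_setIntegral_eq _ _ hl.1 fun B hB _ =>
    (h.2 B hB).trans (hl.2 B hB).symm

theorem IsLogDeriv.hasFiniteFisher {M : POVM Ω H} {φ : H →L[ℂ] H} {l : Ω → ℝ}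
    (hl : IsLogDeriv b S M φ l) (h : MemLp l 2 (outcomeLaw b S M)) :
    HasFiniteFisher b S M φ :=
  (memLp_congr_ae hl.ae_eq_logDeriv).2 h

end Law

/-! ### Spectral formulas for traces -/

section Spectral

variable {ι H : Type*} [NormedAddCommGroup H] [InnerProductSpace ℂ H] [CompleteSpace H]
  {b : HilbertBasis ι ℂ H} {S φ T Z : H →L[ℂ] H} {A : H →ₗ.[ℂ] H} {E : POVM ℝ H} {B : Set ℝ}

theorem integrableOn_of_isBounded {μ : Measure ℝ} [IsFiniteMeasure μ] (hB : MeasurableSet B)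
    (hb : Bornology.IsBounded B) {f : ℝ → ℝ} (hf : Continuous f) : IntegrableOn f B μ := by
  obtain ⟨R, hR⟩ := hb.exists_norm_le
  obtain ⟨K, hK⟩ := (isCompact_Icc (a := -R) (b := R)).exists_bound_of_continuousOn hf.continuousOn
  refine Integrable.of_bound hf.aestronglyMeasurable K ?_
  filter_upwards [ae_restrict_mem hB] with t ht
  exact hK t (abs_le.1 (hR t ht))

theorem trace_mul_truncation (hE : IsSpectralMeasure E A) (hA : IsSelfAdjoint A)
    (hB : MeasurableSet B) (hb : Bornology.IsBounded B)
    (hZ : IsSpectralMeasure.IsTruncation E A B Z) (hS : 0 ≤ S) (hT : IsTraceClass b S) :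
    (trace b (S * Z)).re = ∫ t in B, t ∂(law b S E) := by
  have := isFiniteMeasure_law hS hT E
  have h := Complex.hasSum_re (hasSum_trace_mul hS hT Z)
  simp only [hZ.inner_self hE hA hB, Complex.ofReal_re] at h
  have hi : Integrable (fun t : ℝ => t) ((law b S E).restrict B) :=
    integrableOn_of_isBounded hB hb continuous_id
  rw [law, Measure.restrict_sum _ hB] at hi ⊢
  exact h.unique (hasSum_integral_measure hi)

theorem trace_mul_truncation_sq (hE : IsSpectralMeasure E A) (hA : IsSelfAdjoint A)
    (hB : MeasurableSet B) (hb : Bornology.IsBounded B)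
    (hZ : IsSpectralMeasure.IsTruncation E A B Z) (hS : 0 ≤ S) (hT : IsTraceClass b S) :
    (trace b (S * (Z * Z))).re = ∫ t in B, t ^ 2 ∂(law b S E) := by
  have := isFiniteMeasure_law hS hT E
  have h := Complex.hasSum_re (hasSum_trace_mul hS hT (Z * Z))
  have hsa : star Z = Z := hZ.isSelfAdjoint hE hA hB
  have h1 : ∀ x, (⟪x, (Z * Z) x⟫_ℂ).re = ∫ t in B, t ^ 2 ∂(E.diag x) := fun x => by
    rw [← hZ.norm_sq hE hA hB hb, inner_mul_apply, hsa, inner_self_eq_norm_sq_to_K]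
    norm_cast
  simp only [h1] at h
  have hi : Integrable (fun t : ℝ => t ^ 2) ((law b S E).restrict B) :=
    integrableOn_of_isBounded hB hb (by fun_prop)
  rw [law, Measure.restrict_sum _ hB] at hi ⊢
  exact h.unique (hasSum_integral_measure hi)

theorem IsLogDeriv.trace_mul_truncation (hE : IsSpectralMeasure E A) (hA : IsSelfAdjoint A)
    (hB : MeasurableSet B) (hb : Bornology.IsBounded B)
    (hZ : IsSpectralMeasure.IsTruncation E A B Z) (hφ : IsTraceClass b φ) (hsa : IsSelfAdjoint φ)
    {l : ℝ → ℝ} (hl : IsLogDeriv b S E φ l) :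
    (trace b (φ * Z)).re = ∫ t in B, t * l t ∂(outcomeLaw b S E) := by
  obtain ⟨F, G, hF, hG, hF', hG', rfl⟩ := hφ.exists_eq_sub hsa
  have := isFiniteMeasure_law hF hF' E
  have := isFiniteMeasure_law hG hG' E
  obtain ⟨R, hR⟩ := hb.exists_norm_le
  have hbd : ∀ t, |B.indicator id t| ≤ max R 0 := fun t => by
    by_cases ht : t ∈ B
    · simpa [ht] using Or.inl (hR t ht)
    · simp [ht]
  have h := integral_sub_integral_of_density hl.1 (μ₁ := law b F E) (μ₂ := law b G E)
    (fun C hC => by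
      rw [hl.2 C hC, law_real hF hF' E hC, law_real hG hG' E hC,
        sub_mul, (hF'.mul_right _).trace_sub (hG'.mul_right _), Complex.sub_re])
    (measurable_id.indicator hB) hbd
  rw [integral_indicator hB, integral_indicator hB] at h
  rw [sub_mul, (hF'.mul_right _).trace_sub (hG'.mul_right _), Complex.sub_re,
    QMeas.trace_mul_truncation hE hA hB hb hZ hF hF',
    QMeas.trace_mul_truncation hE hA hB hb hZ hG hG']
  refine h.trans ?_
  rw [← integral_indicator hB]
  congr 1
  ext t
  by_cases ht : t ∈ B <;> simp [ht]

theorem isBounded_inter_Icc (C : Set ℝ) (n : ℕ) :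
    Bornology.IsBounded (C ∩ Set.Icc (-(n : ℝ)) n) :=
  (Metric.isBounded_Icc _ _).subset Set.inter_subset_right

theorem iUnion_Icc_nat : ⋃ n : ℕ, Set.Icc (-(n : ℝ)) n = Set.univ := by
  refine Set.eq_univ_of_forall fun t => ?_
  obtain ⟨n, hn⟩ := exists_nat_ge |t|
  exact Set.mem_iUnion.2 ⟨n, abs_le.1 hn⟩

theorem monotone_Icc_nat : Monotone fun n : ℕ => Set.Icc (-(n : ℝ)) n := fun m n h => by
  have : (m : ℝ) ≤ n := by exact_mod_cast h
  exact Set.Icc_subset_Icc (by linarith) this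

/-- Convergence is even strong: the squared norm of the difference is the diagonal measure of C \
[−n, n], which decreases to that of the empty set. -/
theorem tendsto_effect_inter_Icc (hE : E.IsPVM) {C : Set ℝ} (hC : MeasurableSet C) (x y : H) :
    Filter.Tendsto (fun n : ℕ => ⟪x, E.effect (C ∩ Set.Icc (-(n : ℝ)) n) y⟫_ℂ) Filter.atTop
      (nhds ⟪x, E.effect C y⟫_ℂ) := by
  have hm : ∀ n : ℕ, MeasurableSet (C ∩ Set.Icc (-(n : ℝ)) n) := fun n =>
    hC.inter measurableSet_Icc
  have hm' : ∀ n : ℕ, MeasurableSet (C \ Set.Icc (-(n : ℝ)) n) := fun n =>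
    hC.diff measurableSet_Icc
  suffices h : Filter.Tendsto (fun n : ℕ => E.effect (C ∩ Set.Icc (-(n : ℝ)) n) y) Filter.atTop
      (nhds (E.effect C y)) from tendsto_const_nhds.inner h
  have hsub : ∀ n : ℕ, E.effect C y - E.effect (C ∩ Set.Icc (-(n : ℝ)) n) y
      = E.effect (C \ Set.Icc (-(n : ℝ)) n) y := fun n => by
    have := E.effect_union (hm n) (hm' n) Set.disjoint_sdiff_inter.symm
    rw [Set.inter_union_sdiff] at this
    rw [this, add_apply, add_sub_cancel_left]
  have hnorm : ∀ n : ℕ, ‖E.effect C y - E.effect (C ∩ Set.Icc (-(n : ℝ)) n) y‖ ^ 2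
      = (E.diag y).real (C \ Set.Icc (-(n : ℝ)) n) := fun n => by
    rw [hsub, E.diag_real _ (hm' n)]
    have h1 := E.inner_effect_left (hm' n) y (E.effect (C \ Set.Icc (-(n : ℝ)) n) y)
    rw [hE.apply_apply (hm' n) (hm' n), Set.inter_self, inner_self_eq_norm_sq_to_K] at h1
    rw [← h1]
    norm_cast
  have hlim : Filter.Tendsto (fun n : ℕ => (E.diag y).real (C \ Set.Icc (-(n : ℝ)) n))
      Filter.atTop (nhds 0) := by
    have h := tendsto_measure_iInter_atTop (μ := E.diag y)
      (s := fun n : ℕ => C \ Set.Icc (-(n : ℝ)) n) (fun n => (hm' n).nullMeasurableSet)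
      (fun m n h => Set.sdiff_subset_sdiff_right (monotone_Icc_nat h))
      ⟨0, measure_ne_top _ _⟩
    rw [← Set.sdiff_iUnion, iUnion_Icc_nat, Set.sdiff_univ, measure_empty] at h
    exact (ENNReal.tendsto_toReal ENNReal.zero_ne_top).comp h
  simp only [← hnorm] at hlim
  rw [tendsto_iff_norm_sub_tendsto_zero]
  have h := (Real.continuous_sqrt.tendsto 0).comp hlim
  simp only [Function.comp_def, Real.sqrt_sq (norm_nonneg _), Real.sqrt_zero] at h
  simpa only [norm_sub_rev] using h

theorem IsTraceClass.tendsto_trace_effect (hT : IsTraceClass b T) (hE : E.IsPVM) {C : Set ℝ}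
    (hC : MeasurableSet C) :
    Filter.Tendsto (fun n : ℕ => (trace b (T * E.effect (C ∩ Set.Icc (-(n : ℝ)) n))).re)
      Filter.atTop (nhds (trace b (T * E.effect C)).re) :=
  (Complex.continuous_re.tendsto _).comp <| hT.tendsto_trace_mul
    (fun _ => E.norm_effect_le hE (hC.inter measurableSet_Icc)) (tendsto_effect_inter_Icc hE hC)

/-- `Tr[φ A E(C)] = ∫_C t l(t) dP(t)`. -/
theorem IsTraceClassProduct.re_trace_mul_effect (hT : IsTraceClassProduct b φ A T)
    (hE : IsSpectralMeasure E A) (hA : IsSelfAdjoint A)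
    (hφ : IsTraceClass b φ) (hsa : IsSelfAdjoint φ) {l : ℝ → ℝ} (hl : IsLogDeriv b S E φ l)
    (hint : Integrable (fun t => t * l t) (outcomeLaw b S E)) {C : Set ℝ} (hC : MeasurableSet C) :
    (trace b (T * E.effect C)).re = ∫ t in C, t * l t ∂(outcomeLaw b S E) := by
  have h1 := hT.1.tendsto_trace_effect hE.isPVM hC
  have h2 := tendsto_setIntegral_of_monotone (μ := outcomeLaw b S E) (f := fun t => t * l t)
    (s := fun n : ℕ => C ∩ Set.Icc (-(n : ℝ)) n) (fun n => hC.inter measurableSet_Icc)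
    (fun m n h => Set.inter_subset_inter_right C (monotone_Icc_nat h)) hint.integrableOn
  rw [← Set.inter_iUnion, iUnion_Icc_nat, Set.inter_univ] at h2
  refine tendsto_nhds_unique h1 (h2.congr fun n => ?_)
  have hB := hC.inter (measurableSet_Icc (a := -(n : ℝ)) (b := n))
  obtain ⟨Z, hZ⟩ := hE.exists_isTruncation hA hB (isBounded_inter_Icc C n)
  rw [← hl.trace_mul_truncation hE hA hB (isBounded_inter_Icc C n) hZ hφ hsa]
  -- E(C ∩ [−n, n]) maps into dom A, so multiplying `T` by it gives `φ * Z` with the bounded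
  -- truncation `Z`.
  congr 2
  ext x
  obtain ⟨h, hx⟩ := hZ x
  rw [mul_apply_eq_comp, mul_apply_eq_comp, hx]
  exact (hT.2 ⟨_, h⟩).symm

theorem exists_pmapSq_apply (x : A.domain) (h : A x ∈ A.domain) :
    ∃ hx : (x : H) ∈ (pmapSq A).domain, pmapSq A ⟨x, hx⟩ = A ⟨A x, h⟩ := by
  refine ⟨⟨⟨x, h, rfl⟩, x.2⟩, ?_⟩
  change A ⟨A.domRestrict _ _, _⟩ = _
  congr 1

/-- The second moment of the outcome distribution is `Tr[ρ A²]`. -/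
theorem IsTraceClassProduct.second_moment (hT : IsTraceClassProduct b S (pmapSq A) T)
    (hE : IsSpectralMeasure E A) (hA : IsSelfAdjoint A) (hS : IsDensity b S) :
    Integrable (fun t => t ^ 2) (outcomeLaw b S E) ∧
      ∫ t, t ^ 2 ∂(outcomeLaw b S E) = (trace b T).re := by
  have := (outcomeLaw_spec hS E).1
  have hcover : AECover (outcomeLaw b S E) Filter.atTop fun n : ℕ => Set.Icc (-(n : ℝ)) n :=
    aecover_Icc (Filter.tendsto_neg_atTop_atBot.comp tendsto_natCast_atTop_atTop)
      tendsto_natCast_atTop_atTop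
  have hlim : Filter.Tendsto (fun n : ℕ => ∫ t in Set.Icc (-(n : ℝ)) n, t ^ 2 ∂(outcomeLaw b S E))
      Filter.atTop (nhds (trace b T).re) := by
    have h := hT.1.tendsto_trace_effect hE.isPVM MeasurableSet.univ
    rw [E.effect_univ, mul_one] at h
    refine h.congr fun n => ?_
    rw [Set.univ_inter]
    have hB := measurableSet_Icc (a := -(n : ℝ)) (b := n)
    obtain ⟨Z, hZ⟩ := hE.exists_isTruncation hA hB (Metric.isBounded_Icc _ _)
    rw [outcomeLaw_eq_law hS, ← trace_mul_truncation_sq hE hA hB (Metric.isBounded_Icc _ _) hZ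
      hS.nonneg hS.traceClass]
    congr 2
    ext x
    obtain ⟨h, hx⟩ := hZ x
    obtain ⟨h', hx'⟩ := hZ (Z x)
    have hd : Z x ∈ A.domain := by rw [← hZ.effect_apply hE hA hB]; exact h'
    obtain ⟨h2, hx2⟩ := exists_pmapSq_apply ⟨_, h⟩ (hx ▸ hd)
    rw [mul_apply_eq_comp, mul_apply_eq_comp, mul_apply_eq_comp, hx']
    refine (hT.2 ⟨_, h2⟩).trans ?_
    rw [hx2]
    congr 2
    exact Subtype.ext (hx.symm.trans (hZ.effect_apply hE hA hB x).symm)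
  -- Integrability is a conclusion: the integrand is nonnegative and its integrals over [−n, n]
  -- converge to a finite trace.
  have hi : Integrable (fun t => t ^ 2) (outcomeLaw b S E) :=
    hcover.integrable_of_integral_tendsto_of_nonneg_ae _
      (fun n => integrableOn_of_isBounded measurableSet_Icc (Metric.isBounded_Icc _ _)
        (by fun_prop)) (Filter.Eventually.of_forall fun t => sq_nonneg t) hlim
  exact ⟨hi, hcover.integral_eq_of_tendsto _ hi hlim⟩

theorem IsTraceClassProduct.unique (hA : IsSelfAdjoint A) {T' : H →L[ℂ] H}
    (hT : IsTraceClassProduct b S A T) (hT' : IsTraceClassProduct b S A T') : T = T' := by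
  refine DFunLike.coe_injective (T.continuous.ext_on hA.dense_domain T'.continuous fun x hx => ?_)
  exact (hT.2 ⟨x, hx⟩).trans (hT'.2 ⟨x, hx⟩).symm

theorem IsTraceClassProduct.expectation_eq (hA : IsSelfAdjoint A)
    (hT : IsTraceClassProduct b S A T) : expectation b S A = (trace b T).re := by
  have h : HasFiniteExpectation b S A := ⟨T, hT⟩
  rw [expectation, dif_pos h, h.choose_spec.unique hA hT]

theorem HasFiniteExpectation.exists_eq {A : H →ₗ.[ℂ] H} (h : HasFiniteExpectation b S A) :
    ∃ T, IsTraceClassProduct b S A T ∧ expectation b S A = (trace b T).re :=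
  ⟨h.choose, h.choose_spec, by rw [expectation, dif_pos h]⟩

end Spectral

/-! ### The weak form of the Fisher equation -/

section Weak

variable {ι Ω H : Type*} [MeasurableSpace Ω]
  [NormedAddCommGroup H] [InnerProductSpace ℂ H] [CompleteSpace H]
  {b : HilbertBasis ι ℂ H} {S T : H →L[ℂ] H} {M : POVM Ω H}

/-- The self-adjoint part of `T`, shifted by a multiple of `S` to have trace `0`. -/
noncomputable def tangentPart (b : HilbertBasis ι ℂ H) (S T : H →L[ℂ] H) : H →L[ℂ] H :=
  (2⁻¹ : ℝ) • (T + star T) - (trace b T).re • S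

/-- Tr[T*Z] is the complex conjugate of Tr[TZ] when Z is self-adjoint, so symmetrizing T leaves the
real part alone. -/
theorem re_trace_symm_mul (hT : IsTraceClass b T) {Z : H →L[ℂ] H} (hZ : star Z = Z) :
    (trace b (((2⁻¹ : ℝ) • (T + star T)) * Z)).re = (trace b (T * Z)).re := by
  have h : trace b (star T * Z) = star (trace b (T * Z)) := by
    rw [hT.trace_mul_comm, ← trace_star, star_mul, hZ]
  rw [smul_mul_assoc, trace_smul_real, add_mul, (hT.mul_right Z).trace_add (hT.star.mul_right Z), h]
  simp [Complex.mul_re]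
  ring

theorem re_trace_tangentPart_mul (hS : IsDensity b S) (hT : IsTraceClass b T) {Z : H →L[ℂ] H}
    (hZ : star Z = Z) : (trace b (tangentPart b S T * Z)).re
      = (trace b (T * Z)).re - (trace b T).re * (trace b (S * Z)).re := by
  rw [tangentPart, sub_mul, (((hT.add hT.star).smul_real _).mul_right Z).trace_sub
    ((hS.traceClass.smul_real _).mul_right Z), Complex.sub_re, re_trace_symm_mul hT hZ,
    smul_mul_assoc, trace_smul_real, Complex.re_ofReal_mul]

theorem isTangent_tangentPart (hS : IsDensity b S) (hT : IsTraceClass b T) :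
    IsTangent b (tangentPart b S T) := by
  have hsa : IsSelfAdjoint (tangentPart b S T) := by
    rw [IsSelfAdjoint, tangentPart]
    simp only [star_sub, star_smul, star_add, star_star, star_trivial, add_comm,
      show star S = S from hS.isPositive.isSelfAdjoint]
  refine ⟨hsa, ((hT.add hT.star).smul_real _).sub (hS.traceClass.smul_real _), ?_⟩
  apply Complex.ext
  · have h := re_trace_tangentPart_mul hS hT (Z := 1) (star_one _)
    simp only [mul_one, hS.trace_eq_one, Complex.one_re, sub_self] at h
    simpa using h
  · have h := trace_star (b := b) (tangentPart b S T)
    rw [hsa.star_eq] at h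
    exact Complex.conj_eq_iff_im.1 h.symm

theorem isLogDeriv_tangentPart (hS : IsDensity b S) (hT : IsTraceClass b T) {f : Ω → ℝ}
    (hf : Integrable f (outcomeLaw b S M))
    (h : ∀ C, MeasurableSet C →
      (trace b (T * M.effect C)).re = ∫ x in C, f x ∂(outcomeLaw b S M)) :
    IsLogDeriv b S M (tangentPart b S T) fun x => f x - (trace b T).re := by
  have hP := (outcomeLaw_spec hS M).1
  refine ⟨hf.sub (integrable_const _), fun C hC => ?_⟩
  rw [integral_sub hf.integrableOn (integrable_const _), ← h C hC, setIntegral_const,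
    (outcomeLaw_spec hS M).2 C hC, re_trace_tangentPart_mul hS hT (M.star_effect hC), smul_eq_mul,
    mul_comm (trace b T).re]

/-- Lets the trace formula for directions be applied to the state itself. -/
theorem isLogDeriv_self (hS : IsDensity b S) : IsLogDeriv b S M S fun _ => 1 := by
  have hP := (outcomeLaw_spec hS M).1
  refine ⟨integrable_const _, fun C hC => ?_⟩
  rw [setIntegral_const, (outcomeLaw_spec hS M).2 C hC, smul_eq_mul, mul_one]

theorem IsLogDeriv.integral_eq_zero {φ : H →L[ℂ] H} {l : Ω → ℝ} (hl : IsLogDeriv b S M φ l)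
    (hφ : IsTangent b φ) : ∫ x, l x ∂(outcomeLaw b S M) = 0 := by
  have h := hl.2 _ MeasurableSet.univ
  rw [M.effect_univ, mul_one, hφ.trace_eq_zero, Measure.restrict_univ] at h
  simpa using h

variable {A : H →ₗ.[ℂ] H} {E : POVM ℝ H} {T₁ φ : H →L[ℂ] H}

/-- The data of the theorem: `ρ` is a strictly positive density operator, `E` the spectral measure
of `A`, and `T₁` the trace class extension of `ρ A`, where `ρ A²` is trace class too. -/
structure SpectralMeasurement (b : HilbertBasis ι ℂ H) (ρ : H →L[ℂ] H) (A : H →ₗ.[ℂ] H)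
    (E : POVM ℝ H) (T₁ : H →L[ℂ] H) : Prop where
  density : IsDensity b ρ
  pos : IsStrictlyPositiveOp ρ
  selfAdjoint : IsSelfAdjoint A
  spectral : IsSpectralMeasure E A
  product : IsTraceClassProduct b ρ A T₁
  finite_sq : HasFiniteExpectation b ρ (pmapSq A)

namespace SpectralMeasurement

variable (h : SpectralMeasurement b S A E T₁)
include h

theorem isProbabilityMeasure : IsProbabilityMeasure (outcomeLaw b S E) :=
  (outcomeLaw_spec h.density E).1

theorem second_moment : Integrable (fun t => t ^ 2) (outcomeLaw b S E) ∧
    ∫ t, t ^ 2 ∂(outcomeLaw b S E) = expectation b S (pmapSq A) := by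
  obtain ⟨T₂, hT₂, hT₂'⟩ := h.finite_sq.exists_eq
  rw [hT₂']
  exact hT₂.second_moment h.spectral h.selfAdjoint h.density

theorem memLp_id : MemLp (fun t : ℝ => t) 2 (outcomeLaw b S E) :=
  (memLp_two_iff_integrable_sq (by fun_prop)).2 h.second_moment.1

theorem integrable_id : Integrable (fun t : ℝ => t) (outcomeLaw b S E) :=
  have := h.isProbabilityMeasure
  h.memLp_id.integrable (by norm_num)

theorem re_trace_product_mul_effect {C : Set ℝ} (hC : MeasurableSet C) :
    (trace b (T₁ * E.effect C)).re = ∫ t in C, t ∂(outcomeLaw b S E) := by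
  have := h.product.re_trace_mul_effect h.spectral h.selfAdjoint h.density.traceClass
    h.density.isPositive.isSelfAdjoint (isLogDeriv_self h.density (M := E))
    (by simpa using h.integrable_id) hC
  simpa using this

theorem re_trace_product : (trace b T₁).re = ∫ t, t ∂(outcomeLaw b S E) := by
  simpa [E.effect_univ] using h.re_trace_product_mul_effect MeasurableSet.univ

theorem variance_eq : variance b S A = ∫ t, (t - (trace b T₁).re) ^ 2 ∂(outcomeLaw b S E) := by
  have := h.isProbabilityMeasure
  have h1 : ∀ t : ℝ, (t - (trace b T₁).re) ^ 2
      = t ^ 2 - (2 * (trace b T₁).re) * t + (trace b T₁).re ^ 2 := fun t => by ring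
  simp only [h1]
  have h2 : Integrable (fun t => t ^ 2 - (2 * (trace b T₁).re) * t) (outcomeLaw b S E) :=
    h.second_moment.1.sub (h.integrable_id.const_mul _)
  rw [integral_add h2 (integrable_const _), integral_sub h.second_moment.1 (h.integrable_id.const_mul _), integral_const_mul,
    ← h.re_trace_product, h.second_moment.2, variance, h.product.expectation_eq h.selfAdjoint]
  simp
  ring

/-- The direction solving the Fisher equation: its logarithmic derivative is `t - ⟨A⟩`. -/
theorem isLogDeriv_solution : IsLogDeriv b S E (tangentPart b S T₁)
    fun t => t - (trace b T₁).re :=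
  isLogDeriv_tangentPart h.density h.product.1 h.integrable_id
    fun _ hC => h.re_trace_product_mul_effect hC

theorem memLp_solution : MemLp (fun t => t - (trace b T₁).re) 2 (outcomeLaw b S E) :=
  have := h.isProbabilityMeasure
  h.memLp_id.sub (memLp_const _)

theorem isTangent_solution : IsTangent b (tangentPart b S T₁) :=
  isTangent_tangentPart h.density h.product.1

theorem isLogDeriv (hφ : IsTangent b φ) : IsLogDeriv b S E φ (logDeriv b S E φ) :=
  isLogDeriv_logDeriv h.density h.pos h.spectral.isPVM hφ

/-- The constant in t − ⟨A⟩ integrates against l(φ) to zero because Tr φ = 0. What remains is ∫ t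
l(φ) dP, which converges since both factors are in L² and equals the trace. -/
theorem fisherForm_solution (hφ : IsTangent b φ) (hF : HasFiniteFisher b S E φ)
    (hφA : HasFiniteExpectation b φ A) :
    fisherForm b S E (tangentPart b S T₁) φ = expectation b φ A := by
  obtain ⟨T, hT, hT'⟩ := hφA.exists_eq
  have hl := h.isLogDeriv hφ
  have hint : Integrable (fun t => t * logDeriv b S E φ t) (outcomeLaw b S E) :=
    h.memLp_id.integrable_mul hF
  have h1 := hT.re_trace_mul_effect h.spectral h.selfAdjoint hφ.traceClass hφ.isSelfAdjoint hl
    hint MeasurableSet.univ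
  rw [E.effect_univ, mul_one, Measure.restrict_univ] at h1
  rw [hT', h1, fisherForm]
  have h2 : ∫ t, logDeriv b S E (tangentPart b S T₁) t * logDeriv b S E φ t ∂(outcomeLaw b S E)
      = ∫ t, (t * logDeriv b S E φ t - (trace b T₁).re * logDeriv b S E φ t)
        ∂(outcomeLaw b S E) := by
    refine integral_congr_ae ?_
    filter_upwards [h.isLogDeriv_solution.ae_eq_logDeriv] with t ht
    rw [ht, sub_mul]
  rw [h2, integral_sub hint (hl.1.const_mul _), integral_const_mul, hl.integral_eq_zero hφ,
    mul_zero, sub_zero]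

theorem solvesFisherEq : SolvesFisherEq b S E A (tangentPart b S T₁) :=
  ⟨h.isTangent_solution, h.isLogDeriv_solution.hasFiniteFisher h.memLp_solution,
    fun _ hφ hF hφA => h.fisherForm_solution hφ hF hφA⟩

theorem fisherForm_self {ψ : H →L[ℂ] H}
    (hψ : logDeriv b S E ψ =ᵐ[outcomeLaw b S E] fun t => t - (trace b T₁).re) :
    fisherForm b S E ψ ψ = variance b S A := by
  rw [h.variance_eq, fisherForm]
  refine integral_congr_ae ?_
  filter_upwards [hψ] with t ht
  rw [ht, sq]

theorem expectation_eq_zero (hφ : IsTangent b φ) (hF : HasFiniteFisher b S E φ)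
    (hφA : HasFiniteExpectation b φ A) (h0 : fisherForm b S E φ φ = 0) :
    expectation b φ A = 0 := by
  rw [← h.fisherForm_solution hφ hF hφA]
  simp only [fisherForm, ← sq] at h0
  rw [integral_eq_zero_iff_of_nonneg (fun t => sq_nonneg _) hF.integrable_sq] at h0
  rw [fisherForm]
  refine integral_eq_zero_of_ae ?_
  filter_upwards [h0] with t ht
  simp only [Pi.zero_apply, sq_eq_zero_iff] at ht ⊢
  rw [ht, mul_zero]

theorem isLogDeriv_effect {B : Set ℝ} (hB : MeasurableSet B) :
    IsLogDeriv b S E (tangentPart b S (S * E.effect B))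
      fun t => B.indicator 1 t - (trace b (S * E.effect B)).re := by
  have := h.isProbabilityMeasure
  refine isLogDeriv_tangentPart h.density (h.density.traceClass.mul_right _)
    ((integrable_const (1 : ℝ)).indicator hB) fun C hC => ?_
  rw [integral_indicator_one hB, measureReal_restrict_apply hB,
    (outcomeLaw_spec h.density E).2 _ (hB.inter hC), mul_assoc, h.spectral.isPVM.mul_eq hB hC]

/-- On dom A, ρE(B)A = ρA E(B) because the spectral projection commutes with A. Hence the test
directions built from ρE(B) are admissible in the weak equation. -/
theorem product_effect {B : Set ℝ} (hB : MeasurableSet B) :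
    IsTraceClassProduct b (tangentPart b S (S * E.effect B)) A
      ((2⁻¹ : ℝ) • (T₁ * E.effect B + E.effect B * T₁) - (trace b (S * E.effect B)).re • T₁) := by
  have hT := h.product.1
  refine ⟨(((hT.mul_right _).add (hT.mul_left _)).smul_real _).sub (hT.smul_real _), fun x => ?_⟩
  have h1 : T₁ (E.effect B x) = S (E.effect B (A x)) := by
    rw [← h.spectral.apply_effect h.selfAdjoint hB x]
    exact h.product.2 ⟨_, h.spectral.effect_mem_domain hB x.2⟩
  rw [tangentPart, star_mul, E.star_effect hB,
    show star S = S from h.density.isPositive.isSelfAdjoint]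
  simp only [sub_apply, smul_apply, add_apply, mul_apply_eq_comp, h1, h.product.2 x]

/-- All solutions of the Fisher equation have the logarithmic derivative `t - ⟨A⟩`. -/
theorem logDeriv_ae_eq {ψ : H →L[ℂ] H} (hψ : SolvesFisherEq b S E A ψ) :
    logDeriv b S E ψ =ᵐ[outcomeLaw b S E] fun t => t - (trace b T₁).re := by
  have := h.isProbabilityMeasure
  have hl := h.isLogDeriv hψ.isTangent
  refine hl.1.ae_eq_of_forall_setIntegral_eq _ _ h.isLogDeriv_solution.1 fun B hB _ => ?_
  have hχ := isTangent_tangentPart h.density (h.density.traceClass.mul_right (E.effect B))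
  have hχl := h.isLogDeriv_effect hB
  have hT := h.product.1
  have hχF := hχl.hasFiniteFisher (((memLp_const (1 : ℝ)).indicator hB).sub (memLp_const _))
  -- Testing with logarithmic derivative 1_B − P(B) isolates the integral of l(ψ) over `B`, since
  -- l(ψ) has mean zero.
  have h1 := hψ.eq _ hχ hχF ⟨_, h.product_effect hB⟩
  rw [(h.product_effect hB).expectation_eq h.selfAdjoint,
    (((hT.mul_right _).add (hT.mul_left _)).smul_real _).trace_sub (hT.smul_real _),
    trace_smul_real, trace_smul_real, (hT.mul_right _).trace_add (hT.mul_left _),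
    ← hT.trace_mul_comm, Complex.sub_re, Complex.re_ofReal_mul, Complex.re_ofReal_mul,
    Complex.add_re, h.re_trace_product_mul_effect hB, ← (outcomeLaw_spec h.density E).2 B hB] at h1
  have h2 : fisherForm b S E ψ (tangentPart b S (S * E.effect B))
      = ∫ t, (B.indicator (logDeriv b S E ψ) t
        - (trace b (S * E.effect B)).re * logDeriv b S E ψ t) ∂(outcomeLaw b S E) := by
    refine integral_congr_ae ?_
    filter_upwards [hχl.ae_eq_logDeriv] with t ht
    rw [ht]
    by_cases htB : t ∈ B
    · simp [htB]; ring
    · simp [htB]; ring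
  rw [h2, integral_sub (hl.1.indicator hB) (hl.1.const_mul _), integral_const_mul,
    hl.integral_eq_zero hψ.isTangent, integral_indicator hB, mul_zero, sub_zero] at h1
  rw [h1, integral_sub h.integrable_id.integrableOn (integrable_const _), setIntegral_const,
    smul_eq_mul]
  ring

end SpectralMeasurement

end Weak

/-! ### The parameter Hilbert space -/

section ParamSpace

variable {ι H : Type*} [NormedAddCommGroup H] [InnerProductSpace ℂ H] [CompleteSpace H]
  {b : HilbertBasis ι ℂ H} {X Y : H →L[ℂ] H}

theorem IsTraceClass.isHS (hX : IsTraceClass b X) : IsHS b X := by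
  obtain ⟨Y, Z, -, hZ, rfl⟩ := isTraceClass_iff.1 hX
  exact hZ.mul_left Y

theorem IsHS.memℓp (hX : IsHS b X) : Memℓp (fun i => X (b i)) 2 :=
  memℓp_gen (by simpa [IsHS] using hX)

theorem IsHS.toHS_eq (hX : IsHS b X) :
    toHS b X = (⟨fun i => X (b i), hX.memℓp⟩ : lp (fun _ : ι => H) 2) :=
  dif_pos hX.memℓp

theorem IsHS.add (hX : IsHS b X) (hY : IsHS b Y) : IsHS b (X + Y) := by
  refine Summable.of_nonneg_of_le (fun i => by positivity) (fun i => ?_)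
    ((Summable.add hX hY).mul_left 2)
  rw [add_apply]
  have := norm_add_le (X (b i)) (Y (b i))
  nlinarith [sq_nonneg (‖X (b i)‖ - ‖Y (b i)‖), norm_nonneg (X (b i) + Y (b i))]

theorem IsHS.smul (hX : IsHS b X) (c : ℝ) : IsHS b (c • X) := by
  simpa using hX.mul_left ((c : ℂ) • (1 : H →L[ℂ] H))

theorem IsHS.neg (hX : IsHS b X) : IsHS b (-X) := by
  simpa using hX.smul (-1)

theorem IsHS.sub (hX : IsHS b X) (hY : IsHS b Y) : IsHS b (X - Y) := by
  simpa [sub_eq_add_neg] using hX.add hY.neg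

theorem toHS_add (hX : IsHS b X) (hY : IsHS b Y) : toHS b (X + Y) = toHS b X + toHS b Y := by
  rw [hX.toHS_eq, hY.toHS_eq, (hX.add hY).toHS_eq]
  rfl

theorem toHS_smul (hX : IsHS b X) (c : ℝ) : toHS b (c • X) = c • toHS b X := by
  rw [hX.toHS_eq, (hX.smul c).toHS_eq]
  rfl

theorem toHS_sub (hX : IsHS b X) (hY : IsHS b Y) : toHS b (X - Y) = toHS b X - toHS b Y := by
  rw [hX.toHS_eq, hY.toHS_eq, (hX.sub hY).toHS_eq]
  rfl

theorem norm_toHS_sq (hX : IsHS b X) : ‖toHS b X‖ ^ 2 = ∑' i, ‖X (b i)‖ ^ 2 := by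
  rw [hX.toHS_eq]
  have := lp.norm_rpow_eq_tsum (p := 2) (by norm_num)
    (⟨fun i => X (b i), hX.memℓp⟩ : lp (fun _ : ι => H) 2)
  simp only [ENNReal.toReal_ofNat, Real.rpow_ofNat] at this
  exact this

/-- Both squared norms are traces, of XX* and X*X, which agree by cyclicity. -/
theorem norm_toHS_star (hX : IsHS b X) : ‖toHS b (star X)‖ = ‖toHS b X‖ := by
  have h : ∀ {X : H →L[ℂ] H}, IsHS b X → ((‖toHS b X‖ ^ 2 : ℝ) : ℂ) = trace b (star X * X) :=
    fun {X} hX => by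
      rw [norm_toHS_sq hX, trace, Complex.ofReal_tsum]
      congr 1
      ext i
      rw [inner_mul_apply, star_star, inner_self_eq_norm_sq_to_K]
      norm_cast
  have h1 := h hX.star
  rw [star_star, hX.trace_mul_comm hX.star, ← h hX] at h1
  exact (pow_left_inj₀ (norm_nonneg _) (norm_nonneg _) two_ne_zero).1 (Complex.ofReal_injective h1)

theorem norm_toHS_mul_le (hX : IsHS b X) {Z : H →L[ℂ] H} (hZ : ‖Z‖ ≤ 1) :
    ‖toHS b (Z * X)‖ ≤ ‖toHS b X‖ := by
  refine (pow_le_pow_iff_left₀ (norm_nonneg _) (norm_nonneg _) two_ne_zero).1 ?_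
  rw [norm_toHS_sq hX, norm_toHS_sq (hX.mul_left Z)]
  refine Summable.tsum_le_tsum (fun i => ?_) (hX.mul_left Z) hX
  rw [mul_apply_eq_comp]
  exact pow_le_pow_left₀ (norm_nonneg _) ((Z.le_of_opNorm_le hZ _).trans (one_mul _).le) 2

variable {R : ℕ → H →L[ℂ] H}

theorem tendsto_toHS_mul_sub (hX : IsHS b X) (hR : ∀ n, ‖R n‖ ≤ 1)
    (hlim : ∀ x, Filter.Tendsto (fun n => R n x) Filter.atTop (nhds x)) :
    Filter.Tendsto (fun n => ‖toHS b (R n * X - X)‖) Filter.atTop (nhds 0) := by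
  have h : Filter.Tendsto (fun n => ∑' i, ‖(R n * X - X) (b i)‖ ^ 2) Filter.atTop
      (nhds (∑' _ : ι, (0 : ℝ))) := by
    refine tendsto_tsum_of_dominated_convergence (Summable.mul_left 4 hX) (fun i => ?_)
      (Filter.Eventually.of_forall fun n i => ?_)
    · have h1 := ((hlim (X (b i))).sub_const (X (b i))).norm.pow 2
      simpa using h1
    · rw [norm_pow, norm_norm, sub_apply, mul_apply_eq_comp]
      have h1 := norm_sub_le (R n (X (b i))) (X (b i))
      have h2 := (R n).le_of_opNorm_le (hR n) (X (b i))
      nlinarith [norm_nonneg (R n (X (b i)) - X (b i))]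
  simp only [← fun n => norm_toHS_sq ((hX.mul_left (R n)).sub hX), tsum_zero] at h
  have h' := (Real.continuous_sqrt.tendsto 0).comp h
  simpa only [Function.comp_def, Real.sqrt_sq (norm_nonneg _), Real.sqrt_zero] using h'

/-- RXR − X = R(XR − X) + (RX − X), and XR − X is the adjoint of RX − X, so the one-sided estimate
serves twice. -/
theorem tendsto_toHS_conj_sub (hX : IsHS b X) (hsa : IsSelfAdjoint X)
    (hRsa : ∀ n, IsSelfAdjoint (R n)) (hR : ∀ n, ‖R n‖ ≤ 1)
    (hlim : ∀ x, Filter.Tendsto (fun n => R n x) Filter.atTop (nhds x)) :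
    Filter.Tendsto (fun n => ‖toHS b (R n * X * R n - X)‖) Filter.atTop (nhds 0) := by
  have h := tendsto_toHS_mul_sub hX hR hlim
  refine squeeze_zero (fun n => norm_nonneg _) (fun n => ?_) (by simpa using h.add h)
  have h1 := (hX.mul_left (R n)).sub hX
  have h2 : star (R n * X - X) = X * R n - X := by
    rw [star_sub, star_mul, (hRsa n).star_eq, hsa.star_eq]
  have h3 : R n * X * R n - X = R n * (X * R n - X) + (R n * X - X) := by
    rw [mul_sub, mul_assoc]
    abel
  rw [h3, ← h2, toHS_add (h1.star.mul_left _) h1]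
  refine (norm_add_le _ _).trans ?_
  gcongr
  exact (norm_toHS_mul_le h1.star (hR n)).trans_eq (norm_toHS_star h1)

/-- Two elements of `Ξ` with the same inner products with all directions are equal. -/
theorem paramSpace_ext {v w : paramSpace b}
    (h : ∀ (φ : H →L[ℂ] H) (hφ : IsTangent b φ), ⟪toParam b hφ, v⟫_ℝ = ⟪toParam b hφ, w⟫_ℝ) :
    v = w := by
  rw [← sub_eq_zero]
  have hz : ∀ z ∈ paramSpace b, ⟪z, ((v - w : paramSpace b) : HS ι H)⟫_ℝ = 0 := by
    have hle : paramSpace b ≤ (Submodule.span ℝ {((v - w : paramSpace b) : HS ι H)})ᗮ := by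
      refine Submodule.topologicalClosure_minimal _ (Submodule.span_le.2 ?_)
        (Submodule.isClosed_orthogonal _)
      rintro _ ⟨φ, hφ, rfl⟩
      rw [SetLike.mem_coe, Submodule.mem_orthogonal_singleton_iff_inner_left]
      have h1 : ⟪toParam b hφ, v - w⟫_ℝ = 0 := by rw [inner_sub_right, h φ hφ, sub_self]
      exact h1
    exact fun z hz => (Submodule.mem_orthogonal_singleton_iff_inner_left).1 (hle hz)
  apply Subtype.ext
  exact inner_self_eq_zero.1 (hz _ (v - w).2)

end ParamSpace

/-! ### Approximation of directions by directions dominated by the state -/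

section Approximation

variable {ι H : Type*} [NormedAddCommGroup H] [InnerProductSpace ℂ H] [CompleteSpace H]
  {b : HilbertBasis ι ℂ H}

/-- Take q_n = (s + c_n)⁻¹ and R_n = s q_n with c_n = 1/(n+1). On the range of s, R_n(sx) − sx =
−c_n R_n x → 0; the range is dense by injectivity, and the R_n are contractions. The factors q_n let
R X R be written as s(qXq)s. -/
theorem exists_approximate_unit {s : H →L[ℂ] H} (hs : 0 ≤ s) (hinj : ∀ x, s x = 0 → x = 0) :
    ∃ R q : ℕ → H →L[ℂ] H, (∀ n, IsSelfAdjoint (R n)) ∧ (∀ n, ‖R n‖ ≤ 1) ∧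
      (∀ n, IsSelfAdjoint (q n)) ∧ (∀ n, R n = s * q n) ∧ (∀ n, R n = q n * s) ∧
      ∀ x, Filter.Tendsto (fun n => R n x) Filter.atTop (nhds x) := by
  have hsa : IsSelfAdjoint s := hs.isSelfAdjoint
  have hspec : ∀ x ∈ spectrum ℝ s, 0 ≤ x := fun x hx => spectrum_nonneg_of_nonneg hs hx
  let c : ℕ → ℝ := fun n => 1 / ((n : ℝ) + 1)
  have hc : ∀ n, 0 < c n := fun n => by positivity
  let f : ℕ → ℝ → ℝ := fun n x => (x + c n)⁻¹
  have hne : ∀ n, ∀ x ∈ spectrum ℝ s, x + c n ≠ 0 := fun n x hx => by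
    have := hspec x hx
    have := hc n
    positivity
  have hf : ∀ n, ContinuousOn (f n) (spectrum ℝ s) := fun n =>
    ContinuousOn.inv₀ (by fun_prop) (hne n)
  let q : ℕ → H →L[ℂ] H := fun n => cfc (f n) s
  let R : ℕ → H →L[ℂ] H := fun n => cfc (fun x => x * f n x) s
  have hRc : ∀ n, ContinuousOn (fun x => x * f n x) (spectrum ℝ s) := fun n =>
    continuousOn_id.mul (hf n)
  have h1 : ∀ n, R n = s * q n := fun n => by
    simp only [R, q]
    rw [cfc_mul (fun x => x) (f n) s continuousOn_id (hf n), cfc_id' ℝ s]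
  have h2 : ∀ n, R n = q n * s := fun n => by
    simp only [R, q, mul_comm _ (f n _)]
    rw [cfc_mul (f n) (fun x => x) s (hf n) continuousOn_id, cfc_id' ℝ s]
  have hnorm : ∀ n, ‖R n‖ ≤ 1 := fun n => by
    refine norm_cfc_le zero_le_one fun x hx => ?_
    have h0 := hspec x hx
    have hc' := hc n
    rw [Real.norm_eq_abs, abs_of_nonneg (mul_nonneg h0 (inv_nonneg.2 (by positivity))),
      ← div_eq_mul_inv, div_le_one (by positivity)]
    linarith
  have hsum : ∀ n, R n * s + c n • R n = s := fun n => by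
    conv_rhs => rw [← cfc_id' ℝ s]
    conv_lhs => enter [1, 2]; rw [← cfc_id' ℝ s]
    simp only [R]
    rw [← cfc_mul _ (fun x => x) s (hRc n) continuousOn_id, ← cfc_const_mul _ _ s (hRc n),
      ← cfc_add s (fun x => x * f n x * x) (fun x => c n * (x * f n x)) ((hRc n).mul continuousOn_id) (continuousOn_const.mul (hRc n))]
    refine cfc_congr fun x hx => ?_
    have := hne n x hx
    simp only [f]
    field_simp
  refine ⟨R, q, fun n => cfc_predicate _ s, hnorm, fun n => cfc_predicate _ s, h1, h2, fun y => ?_⟩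
  have hdense : Dense (Set.range s) := by
    have h3 : (LinearMap.range (s : H →ₗ[ℂ] H))ᗮ = ⊥ := by
      rw [Submodule.eq_bot_iff]
      intro x hx
      refine hinj x ?_
      rw [← inner_self_eq_zero (𝕜 := ℂ)]
      have h4 := (Submodule.mem_orthogonal _ _).1 hx (s (s x)) ⟨s x, rfl⟩
      have h5 := ContinuousLinearMap.isSelfAdjoint_iff_isSymmetric.1 hsa (s x) x
      exact h5.symm.trans h4
    have h4 := (Submodule.topologicalClosure_eq_top_iff).2 h3
    rw [← Submodule.dense_iff_topologicalClosure_eq_top] at h4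
    exact h4
  rw [Metric.tendsto_atTop]
  intro ε hε
  obtain ⟨_, hx, x, rfl⟩ := Metric.dense_iff.1 hdense y (ε / 4) (by positivity)
  rw [Metric.mem_ball, dist_comm, dist_eq_norm] at hx
  obtain ⟨N, hN⟩ := exists_nat_gt (4 * ‖x‖ / ε)
  refine ⟨N, fun n hn => ?_⟩
  have h3 : R n y - y = R n (y - s x) - (y - s x) - c n • R n x := by
    have h4 := congrArg (· x) (hsum n)
    simp only [add_apply, mul_apply_eq_comp, smul_apply] at h4
    rw [map_sub]
    conv_rhs => enter [1, 2, 2]; rw [← h4]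
    abel
  have h4 : ‖R n (y - s x)‖ ≤ ‖y - s x‖ :=
    ((R n).le_of_opNorm_le (hnorm n) _).trans (one_mul _).le
  have h5 : ‖c n • R n x‖ ≤ ε / 4 := by
    rw [norm_smul, Real.norm_of_nonneg (hc n).le]
    have h6 : ‖R n x‖ ≤ ‖x‖ := ((R n).le_of_opNorm_le (hnorm n) _).trans (one_mul _).le
    have h7 : 4 * ‖x‖ < ε * ((n : ℝ) + 1) := by
      rw [div_lt_iff₀ hε] at hN
      have : (N : ℝ) ≤ n := by exact_mod_cast hn
      nlinarith
    calc c n * ‖R n x‖ ≤ c n * ‖x‖ := by gcongr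
      _ ≤ ε / 4 := by
        simp only [c]
        rw [one_div_mul_eq_div, div_le_iff₀ (by positivity)]
        linarith
  rw [dist_eq_norm, h3]
  have h6 := norm_sub_le (R n (y - s x) - (y - s x)) (c n • R n x)
  have h7 := norm_sub_le (R n (y - s x)) (y - s x)
  linarith

theorem IsStrictlyPositiveOp.sqrt_apply_ne_zero {S : H →L[ℂ] H} (hS : 0 ≤ S)
    (hpos : IsStrictlyPositiveOp S) {x : H} (hx : CFC.sqrt S x = 0) : x = 0 := by
  by_contra h
  have h1 := hpos.2 x h
  rw [← CFC.sqrt_mul_sqrt_self S hS, mul_apply_eq_comp, hx, map_zero, inner_zero_right] at h1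
  simp at h1

/-- States remain strictly positive in the directions `√ρ K √ρ`. -/
theorem IsStrictlyPositiveOp.add_smul_conj {S K : H →L[ℂ] H} (hS : 0 ≤ S)
    (hpos : IsStrictlyPositiveOp S) (hK : IsSelfAdjoint K) {ε : ℝ} (hε : 0 ≤ ε)
    (hεK : ε * ‖K‖ < 1) :
    IsStrictlyPositiveOp (S + ε • (CFC.sqrt S * K * CFC.sqrt S)) := by
  have hs : star (CFC.sqrt S) = CFC.sqrt S := (CFC.sqrt_nonneg S).isSelfAdjoint
  refine ⟨?_, fun x hx => ?_⟩
  · rw [IsSelfAdjoint]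
    simp only [star_add, star_smul, star_mul, hs, hK.star_eq, star_trivial,
      show star S = S from hpos.1, mul_assoc]
  · have hx' : 0 < ‖CFC.sqrt S x‖ :=
      norm_pos_iff.2 fun h => hx (hpos.sqrt_apply_ne_zero hS h)
    have h1 : (⟪x, S x⟫_ℂ).re = ‖CFC.sqrt S x‖ ^ 2 := by
      conv_lhs => rw [← CFC.sqrt_mul_sqrt_self S hS]
      rw [inner_mul_apply, hs, inner_self_eq_norm_sq_to_K]
      norm_cast
    have h2 : |(⟪x, (CFC.sqrt S * K * CFC.sqrt S) x⟫_ℂ).re| ≤ ‖K‖ * ‖CFC.sqrt S x‖ ^ 2 := by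
      rw [mul_assoc, inner_mul_apply, hs, mul_apply_eq_comp]
      refine (Complex.abs_re_le_norm _).trans ((norm_inner_le_norm _ _).trans ?_)
      have := K.le_opNorm (CFC.sqrt S x)
      nlinarith
    rw [add_apply, smul_apply, inner_add_right, Complex.add_re, h1,
      inner_smul_right_eq_smul, Complex.real_smul, Complex.re_ofReal_mul]
    have h3 := (abs_le.1 h2).1
    nlinarith [mul_le_mul_of_nonneg_left h3 hε, mul_pos (sub_pos.2 hεK) (pow_pos hx' 2)]

/-- The directions `√ρ K √ρ` are dense in `Ξ`. -/
theorem IsTangent.exists_tendsto_conj {S φ : H →L[ℂ] H} (hS : IsDensity b S)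
    (hpos : IsStrictlyPositiveOp S) (hφ : IsTangent b φ) :
    ∃ (K : ℕ → H →L[ℂ] H) (hχ : ∀ n, IsTangent b (CFC.sqrt S * K n * CFC.sqrt S)),
      (∀ n, IsSelfAdjoint (K n)) ∧
      Filter.Tendsto (fun n => toParam b (hχ n)) Filter.atTop (nhds (toParam b hφ)) := by
  have hS0 := hS.nonneg
  obtain ⟨R, q, hR, hR1, hq, hsq, hqs, hlim⟩ := exists_approximate_unit (CFC.sqrt_nonneg S)
    fun x hx => hpos.sqrt_apply_ne_zero hS0 hx
  let τ : ℕ → ℝ := fun n => (trace b (R n * φ * R n)).re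
  -- The multiple of the identity becomes `τ n • S` after conjugation by √S; as Tr S = 1, this
  -- restores trace zero.
  let K : ℕ → H →L[ℂ] H := fun n => q n * φ * q n - τ n • 1
  have hK : ∀ n, CFC.sqrt S * K n * CFC.sqrt S = R n * φ * R n - τ n • S := fun n => by
    conv_rhs => rw [← CFC.sqrt_mul_sqrt_self S hS0]
    simp only [K]
    rw [mul_sub, sub_mul]
    congr 1
    · conv_rhs => enter [1, 1]; rw [hsq n]
      conv_rhs => enter [2]; rw [hqs n]
      simp only [mul_assoc]
    · simp
  have hφn : ∀ n, IsTraceClass b (R n * φ * R n) := fun n =>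
    (hφ.traceClass.mul_left _).mul_right _
  have hsa : ∀ n, IsSelfAdjoint (R n * φ * R n) := fun n => by
    rw [IsSelfAdjoint, star_mul, star_mul, (hR n).star_eq, hφ.isSelfAdjoint.star_eq, mul_assoc]
  have htr : ∀ n, trace b (R n * φ * R n) = τ n := fun n => by
    have h := trace_star (b := b) (R n * φ * R n)
    rw [(hsa n).star_eq] at h
    exact (Complex.conj_eq_iff_re.1 h.symm).symm
  have hχ : ∀ n, IsTangent b (CFC.sqrt S * K n * CFC.sqrt S) := fun n => by
    rw [hK]
    refine ⟨(hsa n).sub ?_, (hφn n).sub (hS.traceClass.smul_real _), ?_⟩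
    · exact (IsSelfAdjoint.all (τ n)).smul hS.isPositive.isSelfAdjoint
    · rw [(hφn n).trace_sub (hS.traceClass.smul_real _), trace_smul_real, hS.trace_eq_one, htr,
        mul_one, sub_self]
  -- By cyclicity `τ n` is the real part of Tr[φR_n²], which tends to Tr φ = 0, so the correction
  -- disappears in the limit.
  have hτ : Filter.Tendsto τ Filter.atTop (nhds 0) := by
    have h1 : Filter.Tendsto (fun n => trace b (φ * (R n * R n))) Filter.atTop
        (nhds (trace b (φ * 1))) := by
      refine hφ.traceClass.tendsto_trace_mul (C := 1) (fun n => ?_) fun x y => ?_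
      · exact (norm_mul_le _ _).trans (mul_le_one₀ (hR1 n) (norm_nonneg _) (hR1 n))
      · simp only [inner_mul_apply, (hR _).star_eq]
        exact (hlim x).inner (hlim y)
    rw [mul_one, hφ.trace_eq_zero] at h1
    have h2 := (Complex.continuous_re.tendsto _).comp h1
    rw [Complex.zero_re] at h2
    refine h2.congr fun n => ?_
    simp only [Function.comp_apply, τ]
    rw [mul_assoc (R n), ← (hφ.traceClass.mul_right (R n)).trace_mul_comm, mul_assoc]
  refine ⟨K, hχ, fun n => ?_, ?_⟩
  · refine IsSelfAdjoint.sub ?_ ((IsSelfAdjoint.all (τ n)).smul (IsSelfAdjoint.one _))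
    rw [IsSelfAdjoint, star_mul, star_mul, (hq n).star_eq, hφ.isSelfAdjoint.star_eq, mul_assoc]
  · rw [tendsto_subtype_rng, tendsto_iff_norm_sub_tendsto_zero]
    have h1 := tendsto_toHS_conj_sub hφ.traceClass.isHS hφ.isSelfAdjoint hR hR1 hlim
    refine squeeze_zero (fun n => norm_nonneg _) (fun n => ?_)
      (by simpa using h1.add (hτ.abs.mul_const ‖toHS b S‖))
    change ‖toHS b (CFC.sqrt S * K n * CFC.sqrt S) - toHS b φ‖ ≤ _
    rw [hK, toHS_sub (hφn n).isHS (hS.traceClass.isHS.smul _), toHS_smul hS.traceClass.isHS,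
      sub_right_comm, ← toHS_sub (hφn n).isHS hφ.traceClass.isHS]
    refine (norm_sub_le _ _).trans_eq ?_
    rw [norm_smul, Real.norm_eq_abs]

end Approximation

/-! ### Gradients and the Fisher information operator -/

section Gradient

variable {ι H : Type*} [NormedAddCommGroup H] [InnerProductSpace ℂ H] [CompleteSpace H]
  {b : HilbertBasis ι ℂ H} {A : H →ₗ.[ℂ] H} {E : POVM ℝ H} {S T₁ : H →L[ℂ] H}

theorem IsTangent.smul {φ : H →L[ℂ] H} (hφ : IsTangent b φ) (c : ℝ) : IsTangent b (c • φ) :=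
  ⟨(IsSelfAdjoint.all c).smul hφ.isSelfAdjoint, hφ.traceClass.smul_real c, by
    rw [trace_smul_real, hφ.trace_eq_zero, mul_zero]⟩

theorem toParam_smul {φ : H →L[ℂ] H} (hφ : IsTangent b φ) (c : ℝ) :
    toParam b (hφ.smul c) = c • toParam b hφ :=
  Subtype.ext (toHS_smul hφ.traceClass.isHS c)

/-- A gradient represents `φ ↦ Tr[φ A]` in the directions in which states stay positive. -/
theorem IsGradient.inner_eq {g : paramSpace b} (hg : IsGradient b S A g) (hA : IsSelfAdjoint A)
    (hT₁ : IsTraceClassProduct b S A T₁) {χ : H →L[ℂ] H} (hχ : IsTangent b χ) {ε₀ : ℝ}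
    (hε₀ : 0 < ε₀) (hpos : ∀ ε, 0 < ε → ε < ε₀ → IsStrictlyPositiveOp (S + ε • χ)) :
    HasFiniteExpectation b χ A ∧ ⟪g, toParam b hχ⟫_ℝ = expectation b χ A := by
  have key : ∀ η > 0, HasFiniteExpectation b χ A ∧
      |expectation b χ A - ⟪g, toParam b hχ⟫_ℝ| ≤ η * ‖toParam b hχ‖ := by
    intro η hη
    obtain ⟨δ, hδ, h⟩ := hg η hη
    obtain ⟨ε, hε, hε1, hε2⟩ : ∃ ε : ℝ, 0 < ε ∧ ε < ε₀ ∧ ε * ‖toParam b hχ‖ < δ := by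
      have h0 : 0 < δ / (‖toParam b hχ‖ + 1) := by positivity
      -- Halving makes the bounds strict; the `+ 1` covers a direction of norm zero.
      refine ⟨min ε₀ (δ / (‖toParam b hχ‖ + 1)) / 2, by positivity, ?_, ?_⟩
      · have := min_le_left ε₀ (δ / (‖toParam b hχ‖ + 1))
        linarith
      · have h1 := min_le_right ε₀ (δ / (‖toParam b hχ‖ + 1))
        have h2 : δ / (‖toParam b hχ‖ + 1) * (‖toParam b hχ‖ + 1) = δ := by field_simp
        nlinarith [norm_nonneg (toParam b hχ)]
    have hn : ‖toParam b (hχ.smul ε)‖ = ε * ‖toParam b hχ‖ := by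
      rw [toParam_smul, norm_smul, Real.norm_of_nonneg hε.le]
    obtain ⟨⟨T, hT⟩, h2⟩ := h (ε • χ) (hχ.smul ε) (hpos ε hε hε1) (by rwa [hn])
    -- Finiteness of Tr[χA] comes from the gradient hypothesis: χA is the difference quotient of the
    -- products for S + εχ and S.
    have hT' : IsTraceClassProduct b χ A (ε⁻¹ • (T - T₁)) := by
      refine ⟨(hT.1.sub hT₁.1).smul_real _, fun x => ?_⟩
      rw [smul_apply, sub_apply, hT.2, hT₁.2, add_apply, add_sub_cancel_left, smul_apply,
        smul_smul, inv_mul_cancel₀ hε.ne', one_smul]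
    refine ⟨⟨_, hT'⟩, ?_⟩
    rw [hT.expectation_eq hA, hT₁.expectation_eq hA, hn, toParam_smul hχ, inner_smul_right] at h2
    rw [hT'.expectation_eq hA, trace_smul_real, Complex.re_ofReal_mul, hT.1.trace_sub hT₁.1,
      Complex.sub_re]
    have h3 : ε⁻¹ * ((trace b T).re - (trace b T₁).re) - ⟪g, toParam b hχ⟫_ℝ
        = ε⁻¹ * ((trace b T).re - (trace b T₁).re - ε * ⟪g, toParam b hχ⟫_ℝ) := by
      field_simp
    rw [h3, abs_mul, abs_of_pos (inv_pos.2 hε), inv_mul_le_iff₀ hε]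
    linarith
  refine ⟨(key 1 one_pos).1, ?_⟩
  have h1 : |expectation b χ A - ⟪g, toParam b hχ⟫_ℝ| ≤ 0 := by
    refine le_of_forall_pos_le_add fun η hη => ?_
    have h0 : 0 < η / (‖toParam b hχ‖ + 1) := by positivity
    refine (key _ h0).2.trans ?_
    rw [zero_add, div_mul_eq_mul_div, div_le_iff₀ (by positivity)]
    nlinarith [norm_nonneg (toParam b hχ)]
  exact (sub_eq_zero.1 (abs_nonpos_iff.1 h1)).symm

theorem fisherForm_comm {Ω : Type*} [MeasurableSpace Ω] {M : POVM Ω H} (φ χ : H →L[ℂ] H) :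
    fisherForm b S M φ χ = fisherForm b S M χ φ := by
  simp only [fisherForm, mul_comm]

/-- The Fisher form is symmetric on directions; density is used twice, once for each argument. -/
theorem IsFisherOperator.adjoint_eq {Ω : Type*} [MeasurableSpace Ω] {M : POVM Ω H}
    {J : paramSpace b →L[ℝ] paramSpace b} (hJ : IsFisherOperator b S M J) :
    ContinuousLinearMap.adjoint J = J := by
  have h1 : ∀ (χ : H →L[ℂ] H) (hχ : IsTangent b χ),
      ContinuousLinearMap.adjoint J (toParam b hχ) = J (toParam b hχ) := fun χ hχ =>
    paramSpace_ext fun φ hφ => by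
      rw [ContinuousLinearMap.adjoint_inner_right, real_inner_comm, hJ.2 χ φ hχ hφ,
        hJ.2 φ χ hφ hχ, fisherForm_comm]
  ext1 v
  refine paramSpace_ext fun χ hχ => ?_
  rw [ContinuousLinearMap.adjoint_inner_right, ← h1, ContinuousLinearMap.adjoint_inner_left]

/-- Both sides are tested first on the directions √ρ K √ρ, where the gradient is known to represent
Tr[χA] and the weak equation applies; density of these directions in Ξ does the rest. -/
theorem SpectralMeasurement.fisherOperator_apply (h : SpectralMeasurement b S A E T₁)
    {g : paramSpace b} {J : paramSpace b →L[ℝ] paramSpace b} (hg : IsGradient b S A g)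
    (hJ : IsFisherOperator b S E J) : J (toParam b h.isTangent_solution) = g := by
  refine paramSpace_ext fun φ hφ => ?_
  obtain ⟨K, hχ, hK, hlim⟩ := hφ.exists_tendsto_conj h.density h.pos
  have heq : ∀ n, ⟪toParam b (hχ n), J (toParam b h.isTangent_solution)⟫_ℝ
      = ⟪toParam b (hχ n), g⟫_ℝ := fun n => by
    have hpos : ∀ ε, 0 < ε → ε < 1 / (‖K n‖ + 1) →
        IsStrictlyPositiveOp (S + ε • (CFC.sqrt S * K n * CFC.sqrt S)) := fun ε hε hε' =>
      h.pos.add_smul_conj h.density.nonneg (hK n) hε.le (by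
        rw [lt_div_iff₀ (by positivity)] at hε'
        nlinarith [norm_nonneg (K n)])
    obtain ⟨h1, h2⟩ := hg.inner_eq h.selfAdjoint h.product (hχ n) (by positivity) hpos
    rw [real_inner_comm g, h2, hJ.2 _ _ (hχ n) h.isTangent_solution, fisherForm_comm,
      h.fisherForm_solution (hχ n) (hJ.1 _ (hχ n)) h1]
  have h1 := hlim.inner (𝕜 := ℝ) (tendsto_const_nhds (x := J (toParam b h.isTangent_solution)))
  have h2 := hlim.inner (𝕜 := ℝ) (tendsto_const_nhds (x := g))
  exact tendsto_nhds_unique h1 (h2.congr fun n => (heq n).symm)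

/-- The gradient is Jψ with J symmetric, hence orthogonal to ker J, and (Jψ, GJψ) = (ψ, JGJψ) = (ψ,
Jψ), which is the variance. -/
theorem SpectralMeasurement.measurementError_eq_zero (h : SpectralMeasurement b S A E T₁)
    {g : paramSpace b} {J G : paramSpace b →L[ℝ] paramSpace b} (hg : IsGradient b S A g)
    (hJ : IsFisherOperator b S E J) (hG : IsMoorePenrose J G) :
    measurementError J G g (variance b S A) = 0 := by
  have hψ := h.fisherOperator_apply hg hJ
  have hadj := hJ.adjoint_eq
  have hsymm : ∀ v w, ⟪J v, w⟫_ℝ = ⟪v, J w⟫_ℝ := fun v w => by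
    conv_rhs => rw [← hadj]
    rw [ContinuousLinearMap.adjoint_inner_right]
  have hker : g ∈ (LinearMap.ker (J : paramSpace b →ₗ[ℝ] paramSpace b))ᗮ := by
    rw [Submodule.mem_orthogonal]
    intro k hk
    rw [← hψ, ← hsymm, show J k = 0 from hk, inner_zero_left]
  rw [measurementError, if_pos hker, ← hψ, hsymm]
  have h1 : J (G (J (toParam b h.isTangent_solution))) = J (toParam b h.isTangent_solution) :=
    congrArg (· (toParam b h.isTangent_solution)) hG.mul_mul_left
  rw [h1, hJ.2 _ _ h.isTangent_solution h.isTangent_solution,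
    h.fisherForm_self h.isLogDeriv_solution.ae_eq_logDeriv, sub_self]
  rfl

end Gradient

theorem SpectralMeasurement.of_tangent {ι H : Type*} [NormedAddCommGroup H]
    [InnerProductSpace ℂ H] [CompleteSpace H] {b : HilbertBasis ι ℂ H} {ρ₀ θ : H →L[ℂ] H}
    (hρ₀ : IsDensity b ρ₀) (hθ : IsTangent b θ) (hpos : IsStrictlyPositiveOp (ρ₀ + θ))
    {A : H →ₗ.[ℂ] H} (hA : IsSelfAdjoint A) (hexp : HasFiniteExpectation b (ρ₀ + θ) A)
    (hvar : HasFiniteExpectation b (ρ₀ + θ) (pmapSq A)) {E : POVM ℝ H}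
    (hE : IsSpectralMeasure E A) : ∃ T₁, SpectralMeasurement b (ρ₀ + θ) A E T₁ := by
  obtain ⟨T₁, hT₁⟩ := hexp
  refine ⟨T₁, ⟨?_, hρ₀.traceClass.add hθ.traceClass, ?_⟩, hpos, hA, hE, hT₁, hvar⟩
  · rw [ContinuousLinearMap.isPositive_def']
    refine ⟨hpos.1, fun x => ?_⟩
    rw [ContinuousLinearMap.reApplyInnerSelf_apply, inner_re_symm]
    rcases eq_or_ne x 0 with rfl | hx
    · simp
    · exact (hpos.2 x hx).le
  · rw [hρ₀.traceClass.trace_add hθ.traceClass, hρ₀.trace_eq_one, hθ.trace_eq_zero, add_zero]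

end QMeas

theorem mainTheorem10 {ι H : Type*} [NormedAddCommGroup H] [InnerProductSpace ℂ H]
    [CompleteSpace H] [TopologicalSpace.SeparableSpace H] (b : HilbertBasis ι ℂ H)
    (ρ₀ θ : H →L[ℂ] H) (hρ₀ : QMeas.IsDensity b ρ₀) (hθ : QMeas.IsTangent b θ)
    (hpos : QMeas.IsStrictlyPositiveOp (ρ₀ + θ))
    (A : H →ₗ.[ℂ] H) (hA : IsSelfAdjoint A)
    (hexp : QMeas.HasFiniteExpectation b (ρ₀ + θ) A)
    (hvar : QMeas.HasFiniteExpectation b (ρ₀ + θ) (QMeas.pmapSq A))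
    (E : QMeas.POVM ℝ H) (hE : QMeas.IsSpectralMeasure E A) :
    -- the measurement error `ε(A; ρ(θ), E)`, as defined on the Hilbert space `Ξ`, is zero
    (∀ (g : QMeas.paramSpace b) (J G : QMeas.paramSpace b →L[ℝ] QMeas.paramSpace b),
      QMeas.IsGradient b (ρ₀ + θ) A g →
      QMeas.IsFisherOperator b (ρ₀ + θ) E J →
      QMeas.IsMoorePenrose J G →
        QMeas.measurementError J G g (QMeas.variance b (ρ₀ + θ) A) = 0) ∧
    -- the same for every such `A`, in weak form, also if there is no gradient in `Ξ` or no
    -- bounded Fisher information operator: `D⟨A⟩` vanishes on the kernel of the Fisher form, the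
    -- equation `J ψ = ∇⟨A⟩` is solvable, and `(ψ, J ψ) - σ²(A) = 0` for every solution `ψ`
    ((∀ φ : H →L[ℂ] H, QMeas.IsTangent b φ → QMeas.HasFiniteFisher b (ρ₀ + θ) E φ →
        QMeas.HasFiniteExpectation b φ A → QMeas.fisherForm b (ρ₀ + θ) E φ φ = 0 →
          QMeas.expectation b φ A = 0) ∧
      (∃ ψ : H →L[ℂ] H, QMeas.SolvesFisherEq b (ρ₀ + θ) E A ψ) ∧
      ∀ ψ : H →L[ℂ] H, QMeas.SolvesFisherEq b (ρ₀ + θ) E A ψ →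
        QMeas.fisherForm b (ρ₀ + θ) E ψ ψ - QMeas.variance b (ρ₀ + θ) A = 0) := by
  obtain ⟨T₁, h⟩ := QMeas.SpectralMeasurement.of_tangent hρ₀ hθ hpos hA hexp hvar hE
  refine ⟨fun g J G hg hJ hG => h.measurementError_eq_zero hg hJ hG,
    fun φ hφ hF hφA h0 => h.expectation_eq_zero hφ hF hφA h0, ⟨_, h.solvesFisherEq⟩,
    fun ψ hψ => ?_⟩
  rw [h.fisherForm_self (h.logDeriv_ae_eq hψ), sub_self]
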